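/- Let \(X,X_1,X_2,\dots\) be i.i.d. \(\mathbb{Z}\)-valued random variables such that, for some \(\sigma,\delta>0\), \(E(X)=0\), \(E(X^2)=\sigma^2\) and \(E(e^{\delta|X|})<\infty\). Let \(S_0=0\), \(S_k=S_{k-1}+X_k\), and suppose that the random walk \(S\) is irreducible on \(\mathbb{Z}\) (every site is reached from \(0\) with positive probability) and aperiodic (\(\gcd\{k\geq 1: P(S_k=0)>0\}=1\)). Let \(a_*=\inf\{t\in\mathbb{R}: E(e^{tX})<\infty\}\in[-\infty,0)\) and \(b_*=\sup\{t\in\mathbb{R}: E(e^{tX})<\infty\}\in(0,+\infty]\), let \(H(t)=\ln E(e^{tX})\) for \(t\in(a_*,b_*)\) and \(I(x)=\sup_{t\in(a_*,b_*)}\bigl(tx-H(t)\bigr)\), and fix \(a,b\in\mathbb{R}\) with \(a_*<a<b<b_*\). Let \(h\in C^2([0,1])\) be a non-negative concave function with \(h(0)=0\), \(h''<0\) on \([0,1]\) and \(h'([0,1])\subset H'([a,b])\). Set \(h_n(k)=nh(k/n)\) for \(k=0,\dots,n\). Then \(I(h'(s))\) is finite for every \(s\in[0,1]\), \(s\mapsto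 I(h'(s))\) is integrable on \([0,1]\), and there are \(c_+\geq c_->0\) and \(n_0\geq 1\) such that, for every \(n\geq n_0\), \[ e^{-c_+n^{1/3}}\leq e^{n\int_0^1 I(h'(s))\,ds}\,P\bigl(S_k\geq h_n(k)\ \forall k\in\{0,\dots,n\},\ S_n=\lceil h_n(n)\rceil\bigr)\leq e^{-c_-n^{1/3}}. \] -/

import Mathlib

open MeasureTheory ProbabilityTheory

noncomputable section

namespace ObstacleWalk

/-- `S_k = X_1 + ⋯ + X_k`, `S_0 = 0`; the increments are indexed from `0`, so `X i` is `X_{i+1}`. -/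
def walk {Ω : Type*} (X : ℕ → Ω → ℤ) (k : ℕ) (ω : Ω) : ℤ :=
  ∑ i ∈ Finset.range k, X i ω

/-- The walk is irreducible on `ℤ`: from `0` (hence, by translation invariance, from any site) it
visits every site with positive probability. -/
def IsIrreducibleWalk {Ω : Type*} [MeasurableSpace Ω] (X : ℕ → Ω → ℤ) (P : Measure Ω) : Prop :=
  ∀ x : ℤ, ∃ k : ℕ, 0 < P {ω | walk X k ω = x}

/-- The walk is aperiodic: the greatest common divisor of its possible return times
`{k ≥ 1 | P(S_k = 0) > 0}` is `1`. -/
def IsAperiodicWalk {Ω : Type*} [MeasurableSpace Ω] (X : ℕ → Ω → ℤ) (P : Measure Ω) : Prop :=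
  ∀ d : ℕ, (∀ k : ℕ, 1 ≤ k → 0 < P {ω | walk X k ω = 0} → d ∣ k) → d = 1

/-- `a_* = inf {t : ℝ | E(e^{tY}) < ∞}`, which may be `-∞`. -/
def lowerTilt {Ω : Type*} [MeasurableSpace Ω] (Y : Ω → ℝ) (P : Measure Ω) : EReal :=
  sInf ((fun t : ℝ => (t : EReal)) '' integrableExpSet Y P)

/-- `b_* = sup {t : ℝ | E(e^{tY}) < ∞}`, which may be `+∞`. -/
def upperTilt {Ω : Type*} [MeasurableSpace Ω] (Y : Ω → ℝ) (P : Measure Ω) : EReal :=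
  sSup ((fun t : ℝ => (t : EReal)) '' integrableExpSet Y P)

/-- The values `t x - H(t)`, `t ∈ (a_*, b_*)`, with `H = log E(e^{tY})`. -/
def legendreValues {Ω : Type*} [MeasurableSpace Ω] (Y : Ω → ℝ) (P : Measure Ω) (x : ℝ) : Set ℝ :=
  {y | ∃ t : ℝ, lowerTilt Y P < (t : EReal) ∧ (t : EReal) < upperTilt Y P ∧
    y = t * x - cgf Y P t}

/-- The Legendre–Fenchel transform `I(x) = sup_t (t x - H(t))` (meaningful where the supremum is
finite). -/
def rate {Ω : Type*} [MeasurableSpace Ω] (Y : Ω → ℝ) (P : Measure Ω) (x : ℝ) : ℝ :=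
  sSup (legendreValues Y P x)

/-- The derivative of a function on the closed interval `[0,1]` (one-sided at the endpoints). -/
def unitDeriv (h : ℝ → ℝ) : ℝ → ℝ :=
  derivWithin h (Set.Icc 0 1)

/-- The rescaled obstacle `h_n(k) = n h(k/n)`. -/
def obstacle (h : ℝ → ℝ) (n k : ℕ) : ℝ :=
  (n : ℝ) * h ((k : ℝ) / (n : ℝ))

/-- The event `{S ≥ h_n, S_n = ⌈h_n(n)⌉}`. -/
def aboveEvent {Ω : Type*} (X : ℕ → Ω → ℤ) (h : ℝ → ℝ) (n : ℕ) : Set Ω :=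
  {ω | (∀ k : ℕ, k ≤ n → obstacle h n k ≤ (walk X k ω : ℝ)) ∧ walk X n ω = ⌈obstacle h n n⌉}

end ObstacleWalk

end

/-! Write `r = n^{1/3}`. Tilt the law of each increment so that its mean becomes the increment of
the obstacle over that step, and measure heights relative to the obstacle. The normalisations
multiply to the exponential of minus the sum of the rates of the obstacle increments, a Riemann sum
which differs from `n ∫ I(h')` by a bounded amount (`abs_riemann_sum_sub_le`). Since `h'' < 0` and
`H''` is bounded above and away from `0` on `[a,b]`, the tilts decrease by an amount of order `1/n`
per step (`exists_tilt_sequence`). Summation by parts turns this decrease into a penalty of order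
height`/n` per step.

What remains is a centred walk, killed below `0`, in a linear potential of strength `1/n`. At height
`r` the potential costs about `r/n = r⁻²` per step, which is also the cost per step of confining a
centred walk to width `r`. Over `n` steps the total is `n r⁻² = r`. No spectral theory is needed:
explicit functions of the rescaled height `x`, weighted by `exp (τ_k · height)`, are compared with
the killed kernel.

Upper bound: `2 - e^{-x}` is a strict supersolution. Near `0` its strict concavity contracts it, and
away from `0` the potential does (`Centred.satProfile_step`, `backOp_target_le`).

Lower bound: a bump centred at `x = R` loses at most a factor `exp (-O(r⁻²))` per step
(`Centred.bump_step`, `bump_le_backOp`). The tube is joined to both ends by `O(r)` steps of mass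
bounded below: at the start, constant steps steeper than the obstacle; at the end, blocks given by
irreducibility and aperiodicity, which correct the lattice position (`exists_blocks`), and then
constant steps flatter than the obstacle (`exists_le_backOp_target`). The constants are uniform in
time because the tilted increments satisfy common moment bounds (`exists_centred_tilted`). -/

noncomputable section

namespace ObstacleWalk

open scoped ENNReal

/-! ### The killed kernel, its comparison principles and the Markov property -/

section Operators

variable {Ω : Type*} [MeasurableSpace Ω]

/-- One step of the walk with increment `ξ`, killed below the level `c`, acting on functions. -/
def stepOp (P : Measure Ω) (ξ : Ω → ℤ) (c : ℝ) (φ : ℤ → ℝ≥0∞) (z : ℤ) : ℝ≥0∞ :=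
  ∫⁻ ω, (if c ≤ ((z + ξ ω : ℤ) : ℝ) then φ (z + ξ ω) else 0) ∂P

/-- `l` steps of the walk killed below the obstacle `c`, starting at time `k`. -/
def backOp (P : Measure Ω) (ξ : Ω → ℤ) (c : ℕ → ℝ) : ℕ → ℕ → (ℤ → ℝ≥0∞) → ℤ → ℝ≥0∞
  | _, 0, φ => φ
  | k, l + 1, φ => stepOp P ξ (c (k + 1)) (backOp P ξ c (k + 1) l φ)

/-- The event that the walk stays above the obstacle `c` up to time `k`. -/
def stay (X : ℕ → Ω → ℤ) (c : ℕ → ℝ) (k : ℕ) : Set Ω :=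
  {ω | ∀ i ≤ k, c i ≤ (walk X i ω : ℝ)}

variable {P : Measure Ω} {ξ : Ω → ℤ} {X : ℕ → Ω → ℤ}

lemma stepOp_mono {c : ℝ} {φ ψ : ℤ → ℝ≥0∞} (hφ : ∀ z : ℤ, c ≤ z → φ z ≤ ψ z) (z : ℤ) :
    stepOp P ξ c φ z ≤ stepOp P ξ c ψ z := by
  refine lintegral_mono fun ω => ?_
  dsimp only
  split_ifs with h
  · exact hφ _ h
  · exact le_rfl

lemma measurable_ofInt {β : Type*} [MeasurableSpace β] (f : ℤ → β) : Measurable f :=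
  measurable_from_top

lemma stepOp_const_mul (hξ : Measurable ξ) {c : ℝ} {φ : ℤ → ℝ≥0∞} (a : ℝ≥0∞) (z : ℤ) :
    stepOp P ξ c (fun w => a * φ w) z = a * stepOp P ξ c φ z := by
  unfold stepOp
  rw [← lintegral_const_mul]
  · simp only [mul_ite, mul_zero]
  · exact (measurable_ofInt (fun x : ℤ => if c ≤ ((z + x : ℤ) : ℝ) then φ (z + x) else 0)).comp hξ

lemma backOp_mono {c : ℕ → ℝ} {φ ψ : ℤ → ℝ≥0∞} (hφ : ∀ z, φ z ≤ ψ z) (l : ℕ) :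
    ∀ (k : ℕ) (z : ℤ), backOp P ξ c k l φ z ≤ backOp P ξ c k l ψ z := by
  induction l with
  | zero => exact fun _ z => hφ z
  | succ l ih => exact fun k z => stepOp_mono (fun w _ => ih (k + 1) w) z

lemma backOp_const_mul (hξ : Measurable ξ) {c : ℕ → ℝ} {φ : ℤ → ℝ≥0∞} (a : ℝ≥0∞) (l : ℕ) :
    ∀ k, backOp P ξ c k l (fun w => a * φ w) = fun w => a * backOp P ξ c k l φ w := by
  induction l with
  | zero => exact fun _ => rfl
  | succ l ih =>
    intro k
    funext z
    simp only [backOp]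
    rw [ih (k + 1), stepOp_const_mul hξ]

lemma backOp_add {c : ℕ → ℝ} {φ : ℤ → ℝ≥0∞} (m l : ℕ) :
    ∀ k, backOp P ξ c k (l + m) φ = backOp P ξ c k l (backOp P ξ c (k + l) m φ) := by
  induction l with
  | zero => intro k; simp [backOp]
  | succ l ih =>
    intro k
    rw [Nat.succ_add]
    simp only [backOp]
    rw [ih (k + 1), show k + 1 + l = k + (l + 1) by ring]

/-- Comparison of the killed kernel with a one-step supersolution. -/
lemma backOp_le_of_supersolution {c : ℕ → ℝ} {g : ℕ → ℤ → ℝ≥0∞} {m : ℕ}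
    (hg : ∀ k < m, ∀ z : ℤ, c k ≤ z → stepOp P ξ (c (k + 1)) (g (k + 1)) z ≤ g k z) (l : ℕ) :
    ∀ k, k + l = m → ∀ z : ℤ, c k ≤ z → backOp P ξ c k l (g m) z ≤ g k z := by
  induction l with
  | zero => rintro k rfl z -; exact le_rfl
  | succ l ih =>
    intro k hk z hz
    exact (stepOp_mono (fun w hw => ih (k + 1) (by omega) w hw) z).trans (hg k (by omega) z hz)

/-- Comparison of the killed kernel with a one-step subsolution. -/
lemma le_backOp_of_subsolution {c : ℕ → ℝ} {g : ℕ → ℤ → ℝ≥0∞} {k₀ m : ℕ}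
    (hg : ∀ k < m, k₀ ≤ k → ∀ z : ℤ, g k z ≤ stepOp P ξ (c (k + 1)) (g (k + 1)) z) (l : ℕ) :
    ∀ k, k₀ ≤ k → k + l = m → ∀ z : ℤ, g k z ≤ backOp P ξ c k l (g m) z := by
  induction l with
  | zero => rintro k - rfl z; exact le_rfl
  | succ l ih =>
    intro k hk₀ hk z
    exact (hg k (by omega) hk₀ z).trans
      (stepOp_mono (fun w _ => ih (k + 1) (by omega) (by omega) w) z)

lemma le_stepOp_of_atom (hξ : Measurable ξ) {c : ℝ} {φ : ℤ → ℝ≥0∞} {z x : ℤ}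
    (hx : c ≤ ((z + x : ℤ) : ℝ)) :
    P {ω | ξ ω = x} * φ (z + x) ≤ stepOp P ξ c φ z := by
  have hm : MeasurableSet {ω | ξ ω = x} := hξ (measurableSet_singleton x)
  calc P {ω | ξ ω = x} * φ (z + x) = ∫⁻ _ in {ω | ξ ω = x}, φ (z + x) ∂P := by
        rw [setLIntegral_const, mul_comm]
    _ = ∫⁻ ω in {ω | ξ ω = x}, (if c ≤ ((z + ξ ω : ℤ) : ℝ) then φ (z + ξ ω) else 0) ∂P := by
        refine setLIntegral_congr_fun hm fun ω hω => ?_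
        have : ξ ω = x := hω
        simp only [this, if_pos hx]
    _ ≤ stepOp P ξ c φ z := setLIntegral_le_lintegral _ _

/-- Lower bound of the killed kernel by a path of constant steps. -/
lemma le_backOp_const_steps (hξ : Measurable ξ) {c : ℕ → ℝ} {φ : ℤ → ℝ≥0∞} {j : ℤ} {q : ℝ≥0∞}
    (hq : q ≤ P {ω | ξ ω = j}) (l : ℕ) :
    ∀ (k : ℕ) (z : ℤ), (∀ i ≤ l, 1 ≤ i → c (k + i) ≤ z + i * j) →
      q ^ l * φ (z + l * j) ≤ backOp P ξ c k l φ z := by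
  induction l with
  | zero => intro k z _; simp [backOp]
  | succ l ih =>
    intro k z h
    have h1 : c (k + 1) ≤ ((z + j : ℤ) : ℝ) := by
      have := h 1 (by omega) le_rfl
      push_cast at this ⊢
      linarith
    have h2 := ih (k + 1) (z + j) (fun i hi hi1 => by
      have := h (i + 1) (by omega) (by omega)
      rw [show k + 1 + i = k + (i + 1) by ring]
      push_cast at this ⊢
      linarith)
    calc q ^ (l + 1) * φ (z + (l + 1 : ℕ) * j)
        = q * (q ^ l * φ (z + j + l * j)) := by
          rw [pow_succ', mul_assoc]
          congr 3
          push_cast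
          ring
      _ ≤ P {ω | ξ ω = j} * backOp P ξ c (k + 1) l φ (z + j) := mul_le_mul' hq h2
      _ ≤ _ := le_stepOp_of_atom hξ h1

/-- Lower bound of the killed kernel by a path of bounded steps far above the obstacle. -/
lemma le_backOp_list (hξ : Measurable ξ) {c : ℕ → ℝ} {φ : ℤ → ℝ≥0∞} {q : ℝ≥0∞} {C : ℝ}
    (L : List ℤ) (hq : ∀ x ∈ L, q ≤ P {ω | ξ ω = x} ∧ -C ≤ (x : ℝ)) :
    ∀ (k : ℕ) (z : ℤ), (∀ i ≤ L.length, 1 ≤ i → c (k + i) ≤ z - i * C) →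
      q ^ L.length * φ (z + L.sum) ≤ backOp P ξ c k L.length φ z := by
  induction L with
  | nil => intro k z _; simp [backOp]
  | cons x L ih =>
    intro k z h
    obtain ⟨hx, hxC⟩ := hq x (by simp)
    have h1 : c (k + 1) ≤ ((z + x : ℤ) : ℝ) := by
      have := h 1 (by simp) le_rfl
      push_cast at this ⊢
      linarith
    have h2 := ih (fun y hy => hq y (by simp [hy])) (k + 1) (z + x) (fun i hi hi1 => by
      have := h (i + 1) (by simp; omega) (by omega)
      rw [show k + 1 + i = k + (i + 1) by ring]
      push_cast at this ⊢
      linarith)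
    calc q ^ (x :: L).length * φ (z + (x :: L).sum)
        = q * (q ^ L.length * φ (z + x + L.sum)) := by
          rw [List.length_cons, List.sum_cons, pow_succ', mul_assoc, add_assoc]
      _ ≤ P {ω | ξ ω = x} * backOp P ξ c (k + 1) L.length φ (z + x) := mul_le_mul' hx h2
      _ ≤ _ := le_stepOp_of_atom hξ h1

lemma measurable_walk (hX : ∀ i, Measurable (X i)) (k : ℕ) : Measurable (walk X k) := by
  unfold walk
  exact Finset.measurable_fun_sum _ fun i _ => hX i

lemma measurableSet_stay (hX : ∀ i, Measurable (X i)) (c : ℕ → ℝ) (k : ℕ) :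
    MeasurableSet (stay X c k) := by
  have : stay X c k = ⋂ i ∈ Set.Iic k, walk X i ⁻¹' {x : ℤ | c i ≤ (x : ℝ)} := by
    ext ω; simp [stay]
  rw [this]
  exact MeasurableSet.biInter (Set.to_countable _) fun i _ =>
    measurable_walk hX i MeasurableSpace.measurableSet_top

lemma indicator_stay_succ {Ω : Type*} {X : ℕ → Ω → ℤ} (c : ℕ → ℝ) (k : ℕ) (φ : ℤ → ℝ≥0∞) (ω : Ω) :
    (stay X c (k + 1)).indicator (fun ω => φ (walk X (k + 1) ω)) ω =
      (stay X c k).indicator (fun ω => if c (k + 1) ≤ ((walk X k ω + X k ω : ℤ) : ℝ)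
        then φ (walk X k ω + X k ω) else 0) ω := by
  classical
  have hw : walk X (k + 1) ω = walk X k ω + X k ω := Finset.sum_range_succ _ _
  have hs : ω ∈ stay X c (k + 1) ↔ ω ∈ stay X c k ∧ c (k + 1) ≤ ((walk X k ω + X k ω : ℤ) : ℝ) := by
    rw [← hw]
    constructor
    · exact fun h => ⟨fun i hi => h i (by omega), h _ le_rfl⟩
    · rintro ⟨h1, h2⟩ i hi
      rcases Nat.lt_or_eq_of_le hi with hi | rfl
      · exact h1 i (by omega)
      · exact h2
  simp only [Set.indicator_apply, hs, hw]
  split_ifs <;> first | rfl | (exfalso; tauto)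

/-- The Markov property of the walk killed below an obstacle. -/
lemma lintegral_stay_succ [IsProbabilityMeasure P] (hX : ∀ i, Measurable (X i))
    (hindep : iIndepFun X P) (hident : ∀ i, IdentDistrib (X i) (X 0) P P) (c : ℕ → ℝ) (k : ℕ)
    (φ : ℤ → ℝ≥0∞) :
    ∫⁻ ω in stay X c (k + 1), φ (walk X (k + 1) ω) ∂P =
      ∫⁻ ω in stay X c k, stepOp P (X 0) (c (k + 1)) φ (walk X k ω) ∂P := by
  classical
  set U : Ω → (Finset.range k → ℤ) := fun ω i => X i ω with hU
  have hUm : Measurable U := measurable_pi_lambda _ fun i => hX i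
  have hUX : IndepFun U (X k) P := by
    have h := hindep.indepFun_finset (Finset.range k) {k} (by simp) hX
    exact h.comp (φ := id) (ψ := fun v : (({k} : Finset ℕ) → ℤ) => v ⟨k, by simp⟩) measurable_id
      (measurable_pi_apply _)
  -- Rebuilding the walk from its first `k` increments makes survival up to time `k` a function of
  -- `U` alone, so that independence of `U` and `X k` yields a product measure.
  let w : ℕ → (Finset.range k → ℤ) → ℤ := fun i u =>
    ∑ j ∈ Finset.range i, if hj : j ∈ Finset.range k then u ⟨j, hj⟩ else 0
  have hw : ∀ i ≤ k, ∀ ω, w i (U ω) = walk X i ω := by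
    intro i hi ω
    refine Finset.sum_congr rfl fun j hj => ?_
    rw [dif_pos (Finset.range_subset_range.2 hi hj)]
  have hwm : ∀ i, Measurable (w i) := by
    intro i
    refine Finset.measurable_fun_sum _ fun j _ => ?_
    by_cases hj : j ∈ Finset.range k
    · simp only [dif_pos hj]; exact measurable_pi_apply _
    · simp only [dif_neg hj]; exact measurable_const
  let A : Set (Finset.range k → ℤ) := {u | ∀ i ≤ k, c i ≤ (w i u : ℝ)}
  have hA : MeasurableSet A := by
    have : A = ⋂ i ∈ Set.Iic k, w i ⁻¹' {x : ℤ | c i ≤ (x : ℝ)} := by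
      ext u; simp [A]
    rw [this]
    exact MeasurableSet.biInter (Set.to_countable _) fun i _ =>
      hwm i MeasurableSpace.measurableSet_top
  have hAU : ∀ ω, U ω ∈ A ↔ ω ∈ stay X c k := by
    intro ω
    refine forall_congr' fun i => forall_congr' fun hi => ?_
    rw [hw i hi]
  let ψ : ℤ → ℤ → ℝ≥0∞ := fun z x => if c (k + 1) ≤ ((z + x : ℤ) : ℝ) then φ (z + x) else 0
  let Φ : (Finset.range k → ℤ) × ℤ → ℝ≥0∞ := fun p =>
    (Prod.fst ⁻¹' A).indicator (fun p => ψ (w k p.1) p.2) p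
  have hψm : Measurable (fun p : ℤ × ℤ => ψ p.1 p.2) := measurable_from_prod_countable_left
    (fun x => measurable_ofInt _)
  have hΦm : Measurable Φ := by
    refine Measurable.indicator ?_ (measurable_fst hA)
    exact hψm.comp (((hwm k).comp measurable_fst).prodMk measurable_snd)
  rw [← lintegral_indicator (measurableSet_stay hX c (k + 1)),
    ← lintegral_indicator (measurableSet_stay hX c k)]
  simp_rw [indicator_stay_succ]
  calc ∫⁻ ω, (stay X c k).indicator (fun ω => ψ (walk X k ω) (X k ω)) ω ∂P
      = ∫⁻ ω, Φ (U ω, X k ω) ∂P := by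
        refine lintegral_congr fun ω => ?_
        simp only [Φ, Set.indicator_apply, Set.mem_preimage, hAU, hw k le_rfl]
    _ = ∫⁻ p, Φ p ∂((P.map U).prod (P.map (X k))) := by
        rw [← (indepFun_iff_map_prod_eq_prod_map_map hUm.aemeasurable
          (hX k).aemeasurable).1 hUX, lintegral_map hΦm (hUm.prodMk (hX k))]
    _ = ∫⁻ u, ∫⁻ x, Φ (u, x) ∂(P.map (X k)) ∂(P.map U) := by
        have := Measure.isProbabilityMeasure_map (μ := P) (hX k).aemeasurable
        rw [lintegral_prod _ hΦm.aemeasurable]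
    _ = ∫⁻ ω, ∫⁻ ω', Φ (U ω, X 0 ω') ∂P ∂P := by
        have := Measure.isProbabilityMeasure_map (μ := P) (hX k).aemeasurable
        rw [lintegral_map hΦm.lintegral_prod_right' hUm]
        refine lintegral_congr fun ω => ?_
        rw [(hident k).map_eq]
        exact lintegral_map (hΦm.comp measurable_prodMk_left) (hX 0)
    _ = _ := by
        refine lintegral_congr fun ω => ?_
        simp only [Φ, Set.indicator_apply, Set.mem_preimage, hAU, hw k le_rfl]
        split_ifs
        · rfl
        · simp

/-- The walk killed below an obstacle in terms of the iterated one-step kernel. -/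
lemma lintegral_stay_eq_backOp [IsProbabilityMeasure P] (hX : ∀ i, Measurable (X i))
    (hindep : iIndepFun X P) (hident : ∀ i, IdentDistrib (X i) (X 0) P P) {c : ℕ → ℝ}
    (hc : c 0 ≤ 0) (φ : ℤ → ℝ≥0∞) (n : ℕ) :
    ∫⁻ ω in stay X c n, φ (walk X n ω) ∂P = backOp P (X 0) c 0 n φ 0 := by
  have key : ∀ l k, ∀ φ : ℤ → ℝ≥0∞, ∫⁻ ω in stay X c (k + l), φ (walk X (k + l) ω) ∂P =
      ∫⁻ ω in stay X c k, backOp P (X 0) c k l φ (walk X k ω) ∂P := by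
    intro l
    induction l with
    | zero => intro k φ; rfl
    | succ l ih =>
      intro k φ
      rw [show k + (l + 1) = k + 1 + l by ring, ih (k + 1) φ, lintegral_stay_succ hX hindep hident]
      rfl
  have h0 : stay X c 0 = Set.univ := by
    ext ω; simp [stay, walk, hc]
  have := key n 0 φ
  rw [h0, zero_add] at this
  rw [this]
  simp [walk]

/-- The endpoint constraint becomes the terminal function of the kernel. The constraint at time `0`,
which the kernel never tests, holds because `h 0 = 0`. -/
lemma measure_aboveEvent [IsProbabilityMeasure P] (hX : ∀ i, Measurable (X i))
    (hindep : iIndepFun X P) (hident : ∀ i, IdentDistrib (X i) (X 0) P P) {h : ℝ → ℝ}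
    (h0 : h 0 = 0) (n : ℕ) :
    P (aboveEvent X h n) = backOp P (X 0) (obstacle h n) 0 n
      (Set.indicator {⌈obstacle h n n⌉} 1) 0 := by
  rw [← lintegral_stay_eq_backOp hX hindep hident (by simp [obstacle, h0])]
  have hE : aboveEvent X h n = walk X n ⁻¹' {⌈obstacle h n n⌉} ∩ stay X (obstacle h n) n := by
    ext ω
    simp only [aboveEvent, stay, Set.mem_ofPred_eq, Set.mem_inter_iff, Set.mem_preimage,
      Set.mem_singleton_iff]
    tauto
  have hm : MeasurableSet (walk X n ⁻¹' {⌈obstacle h n n⌉}) :=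
    measurable_walk hX n (measurableSet_singleton _)
  rw [hE, ← Measure.restrict_apply hm, ← lintegral_indicator_one hm]
  rfl

end Operators

/-! ### Lattice paths of charged steps -/

section Gadgets

variable {Ω : Type*} [MeasurableSpace Ω] {P : Measure Ω} {X : ℕ → Ω → ℤ}

/-- `l` steps of positive mass lead from `0` to `x`. -/
def Reach (P : Measure Ω) (ξ : Ω → ℤ) (l : ℕ) (x : ℤ) : Prop :=
  ∃ L : List ℤ, L.length = l ∧ L.sum = x ∧ ∀ y ∈ L, 0 < P {ω | ξ ω = y}

lemma Reach.add {ξ : Ω → ℤ} {l m : ℕ} {x y : ℤ} (hx : Reach P ξ l x) (hy : Reach P ξ m y) :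
    Reach P ξ (l + m) (x + y) := by
  obtain ⟨L, rfl, rfl, hL⟩ := hx
  obtain ⟨M, rfl, rfl, hM⟩ := hy
  refine ⟨L ++ M, by simp, by simp, fun z hz => ?_⟩
  rcases List.mem_append.1 hz with h | h
  exacts [hL z h, hM z h]

/-- The values are countably many, so those of mass zero are together negligible. -/
lemma ae_atom_pos {ξ : Ω → ℤ} : ∀ᵐ ω ∂P, 0 < P {ω' | ξ ω' = ξ ω} := by
  have : ∀ᵐ ω ∂P, ∀ x : ℤ, ξ ω = x → 0 < P {ω' | ξ ω' = x} := by
    rw [ae_all_iff]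
    intro x
    by_cases hx : P {ω' | ξ ω' = x} = 0
    · have h0 : ∀ᵐ ω ∂P, ¬ ξ ω = x := measure_eq_zero_iff_ae_notMem.1 hx
      filter_upwards [h0] with ω hω h
      exact absurd h hω
    · exact Filter.Eventually.of_forall fun ω _ => pos_iff_ne_zero.2 hx
  filter_upwards [this] with ω hω
  exact hω _ rfl

/-- Almost every outcome uses charged increments only, so an event of positive probability contains
such an outcome; its own increments are the required list. -/
lemma reach_of_pos (hident : ∀ i, IdentDistrib (X i) (X 0) P P)
    {k : ℕ} {x : ℤ} (h : 0 < P {ω | walk X k ω = x}) : Reach P (X 0) k x := by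
  have hae : ∀ᵐ ω ∂P, ∀ i, 0 < P {ω' | X 0 ω' = X i ω} := by
    rw [ae_all_iff]
    intro i
    filter_upwards [ae_atom_pos (P := P) (ξ := X i)] with ω hω
    rwa [show P {ω' | X 0 ω' = X i ω} = P {ω' | X i ω' = X i ω} from
      ((hident i).measure_mem_eq (measurableSet_singleton (X i ω))).symm]
  obtain ⟨ω, hω, hpos⟩ := Filter.Frequently.exists
    ((frequently_ae_iff.2 h.ne').and_eventually hae)
  refine ⟨(List.range k).map fun i => X i ω, by simp, ?_, ?_⟩
  · rw [← hω]; simp [walk, Finset.sum, Multiset.range]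
  · intro y hy
    obtain ⟨i, -, rfl⟩ := List.mem_map.1 hy
    exact hpos i

/-- An irreducible aperiodic walk can move by `-1`, `0` and `1` in one common number of steps. -/
lemma exists_common_reach
    (hident : ∀ i, IdentDistrib (X i) (X 0) P P) (hirr : IsIrreducibleWalk X P)
    (haper : IsAperiodicWalk X P) :
    ∃ K, Reach P (X 0) K 0 ∧ Reach P (X 0) K 1 ∧ Reach P (X 0) K (-1) := by
  let s : Set ℕ := {k | Reach P (X 0) k 0}
  let S : AddSubmonoid ℕ :=
    { carrier := s
      zero_mem' := ⟨[], by simp⟩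
      add_mem' := fun {k l} hk hl => by
        have h := Reach.add (show Reach P (X 0) k 0 from hk) (show Reach P (X 0) l 0 from hl)
        rwa [add_zero] at h }
  -- The gcd of the lengths of charged loops divides every possible return time, so aperiodicity
  -- makes it `1`. Hence every large length is the length of a loop.
  have hs : Nat.setGcd s = 1 := haper _ fun k _ hk =>
    Nat.setGcd_dvd_of_mem (reach_of_pos hident hk)
  obtain ⟨N, hN⟩ := Nat.exists_mem_closure_of_ge s
  have hN' : ∀ m ≥ N, Reach P (X 0) m 0 := fun m hm => by
    have h1 := hN m hm (by simp [hs])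
    have h2 : AddSubmonoid.closure s ≤ S := AddSubmonoid.closure_le.2 (fun _ h => h)
    exact h2 h1
  obtain ⟨k, hk⟩ := hirr 1
  obtain ⟨l, hl⟩ := hirr (-1)
  have hk' := reach_of_pos hident hk
  have hl' := reach_of_pos hident hl
  -- Paths to `1` and to `-1` are padded to this length by loops, of lengths `l + N` and `k + N`,
  -- both at least `N`.
  refine ⟨k + l + N, hN' _ (by omega), ?_, ?_⟩
  · have := hk'.add (hN' (l + N) (by omega))
    simpa [add_assoc] using this
  · have := hl'.add (hN' (k + N) (by omega))
    rw [show k + l + N = l + (k + N) by ring]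
    simpa using this

/-- With `G` blocks of `K` bounded steps from a finite set of atoms, an irreducible aperiodic walk
reaches every site at distance at most `G`. -/
lemma exists_blocks
    (hident : ∀ i, IdentDistrib (X i) (X 0) P P) (hirr : IsIrreducibleWalk X P)
    (haper : IsAperiodicWalk X P) [IsProbabilityMeasure P] :
    ∃ (K : ℕ) (C : ℝ) (q : ℝ), 0 < q ∧ 0 ≤ C ∧ ∀ (G : ℕ) (D : ℤ), |D| ≤ G → ∃ L : List ℤ,
      L.length = G * K ∧ L.sum = D ∧
        ∀ x ∈ L, ENNReal.ofReal q ≤ P {ω | X 0 ω = x} ∧ -C ≤ (x : ℝ) := by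
  obtain ⟨K, ⟨L₀, h₀l, h₀s, h₀⟩, ⟨L₁, h₁l, h₁s, h₁⟩, ⟨L₂, h₂l, h₂s, h₂⟩⟩ :=
    exists_common_reach hident hirr haper
  have key : ∀ L : List ℤ, (∀ x ∈ L, 0 < P {ω | X 0 ω = x}) → ∃ (C : ℝ) (q : ℝ), 0 < q ∧ 0 ≤ C ∧
      ∀ x ∈ L, ENNReal.ofReal q ≤ P {ω | X 0 ω = x} ∧ -C ≤ (x : ℝ) := by
    intro L
    induction L with
    | nil => exact fun _ => ⟨0, 1, by norm_num, le_rfl, by simp⟩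
    | cons y L ih =>
      intro h
      obtain ⟨C, q, hq, hC, hL⟩ := ih fun x hx => h x (by simp [hx])
      have hy := h y (by simp)
      have hy' : 0 < P.real {ω | X 0 ω = y} := ENNReal.toReal_pos hy.ne' (measure_ne_top _ _)
      refine ⟨max C |(y : ℝ)|, min q (P.real {ω | X 0 ω = y}), lt_min hq hy',
        le_max_of_le_left hC, fun x hx => ?_⟩
      rcases List.mem_cons.1 hx with rfl | hx
      · refine ⟨?_, ?_⟩
        · rw [← ofReal_measureReal]
          exact ENNReal.ofReal_le_ofReal (min_le_right _ _)
        · have := neg_abs_le (x : ℝ)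
          have := le_max_right C |(x : ℝ)|
          linarith
      · refine ⟨(ENNReal.ofReal_le_ofReal (min_le_left _ _)).trans (hL x hx).1, ?_⟩
        have := (hL x hx).2
        have := le_max_left C |(y : ℝ)|
        linarith
  obtain ⟨C, q, hq, hC, hL⟩ := key (L₀ ++ L₁ ++ L₂) (fun x hx => by
    simp only [List.mem_append] at hx
    rcases hx with (hx | hx) | hx
    exacts [h₀ x hx, h₁ x hx, h₂ x hx])
  refine ⟨K, C, q, hq, hC, fun G => ?_⟩
  induction G with
  | zero =>
    intro D hD
    have : D = 0 := by simpa using hD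
    exact ⟨[], by simp, by simp [this], by simp⟩
  | succ G ih =>
    intro D hD
    -- One block is spent on a displacement `d` equal to the sign of `D`, which leaves a distance of
    -- at most `G`.
    have step : ∀ (M : List ℤ) (d : ℤ), M.length = K → M.sum = d → (∀ x ∈ M, x ∈ L₀ ++ L₁ ++ L₂) →
        |D - d| ≤ G → ∃ L : List ℤ, L.length = (G + 1) * K ∧ L.sum = D ∧
          ∀ x ∈ L, ENNReal.ofReal q ≤ P {ω | X 0 ω = x} ∧ -C ≤ (x : ℝ) := by
      intro M d hMl hMs hM hd
      obtain ⟨L, h1, h2, h3⟩ := ih (D - d) hd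
      refine ⟨M ++ L, ?_, ?_, fun x hx => ?_⟩
      · rw [List.length_append, hMl, h1]; ring
      · rw [List.sum_append, hMs, h2]; ring
      · rcases List.mem_append.1 hx with h | h
        exacts [hL x (hM x h), h3 x h]
    push_cast at hD
    rw [abs_le] at hD
    rcases lt_trichotomy D 0 with h | h | h
    · exact step L₂ (-1) h₂l h₂s (by simp +contextual) (by rw [abs_le]; omega)
    · exact step L₀ 0 h₀l h₀s (by simp +contextual) (by rw [abs_le]; omega)
    · exact step L₁ 1 h₁l h₁s (by simp +contextual) (by rw [abs_le]; omega)

end Gadgets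

/-! ### The two explicit profiles and their Taylor bounds -/

section Profiles

/-- The error is cubic on the whole line, so third moments control it. For `w ≤ -1` the left side is
already nonpositive. -/
lemma quadratic_sub_cube_le_exp (w : ℝ) : 1 + w + w ^ 2 / 2 - |w| ^ 3 ≤ Real.exp w := by
  rcases le_total 0 w with hw | hw
  · have := Real.quadratic_le_exp_of_nonneg hw
    have : 0 ≤ |w| ^ 3 := by positivity
    linarith
  · rcases le_total |w| 1 with h1 | h1
    · have h := Real.exp_bound h1 (n := 3) (by norm_num)
      simp only [Finset.sum_range_succ, Finset.sum_range_zero, Nat.factorial] at h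
      norm_num at h
      have h2 := (abs_le.1 h).1
      have : 0 ≤ |w| ^ 3 := by positivity
      nlinarith
    · rw [abs_of_nonpos hw] at h1 ⊢
      have := Real.exp_pos w
      nlinarith [mul_nonneg (sub_nonneg.2 h1) (sq_nonneg w), sq_nonneg (w + 1)]

/-- The bounded increasing concave profile `2 - e^{-x}`, killed below `0`. -/
def satProfile (x : ℝ) : ℝ := if 0 ≤ x then 2 - Real.exp (-x) else 0

lemma satProfile_of_nonneg {x : ℝ} (hx : 0 ≤ x) : satProfile x = 2 - Real.exp (-x) := if_pos hx

lemma one_le_satProfile {x : ℝ} (hx : 0 ≤ x) : 1 ≤ satProfile x := by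
  have : Real.exp (-x) ≤ 1 := Real.exp_le_one_iff.2 (by linarith)
  rw [satProfile_of_nonneg hx]; linarith

lemma satProfile_le_two (x : ℝ) : satProfile x ≤ 2 := by
  unfold satProfile
  split_ifs
  · linarith [Real.exp_pos (-x)]
  · norm_num

lemma satProfile_nonneg (x : ℝ) : 0 ≤ satProfile x := by
  by_cases hx : 0 ≤ x
  · linarith [one_le_satProfile hx]
  · simp [satProfile, hx]

lemma measurable_satProfile : Measurable satProfile :=
  Measurable.ite measurableSet_Ici (by fun_prop) measurable_const

/-- Where the walk survives this is Taylor's formula. Where it is killed the profile is `0`, and the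
cubic term keeps the right side nonnegative. -/
lemma satProfile_add_le {x : ℝ} (hx : 0 ≤ x) (u : ℝ) :
    satProfile (x + u) ≤ 2 - Real.exp (-x) * (1 - u + u ^ 2 / 2) + 10 * |u| ^ 3 := by
  have he0 := Real.exp_pos (-x)
  have he1 : Real.exp (-x) ≤ 1 := Real.exp_le_one_iff.2 (by linarith)
  have hu3 : 0 ≤ |u| ^ 3 := by positivity
  by_cases h : 0 ≤ x + u
  · rw [satProfile_of_nonneg h, neg_add, Real.exp_add]
    have h1 := quadratic_sub_cube_le_exp (-u)
    rw [abs_neg] at h1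
    nlinarith [mul_le_mul_of_nonneg_left h1 he0.le, mul_nonneg hu3 (sub_nonneg.2 he1)]
  · rw [satProfile, if_neg h]
    have hu : u < 0 := by linarith
    rw [abs_of_neg hu]
    have h2 : Real.exp (-x) * (1 - u + u ^ 2 / 2) ≤ 1 * (1 - u + u ^ 2 / 2) :=
      mul_le_mul_of_nonneg_right he1 (by nlinarith)
    have h3 : 1 - u + u ^ 2 / 2 ≤ 2 + 10 * (-u) ^ 3 := by
      rcases le_total (-u) (1 / 2) with h4 | h4
      · have : 0 ≤ (-u) ^ 3 := pow_nonneg (by linarith) 3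
        nlinarith
      · have : (-u) ^ 3 = (-u) * u ^ 2 := by ring
        rw [this]
        nlinarith [mul_nonneg (sub_nonneg.2 h4) (sq_nonneg u)]
    linarith

/-- The `C^{1,1}` bump `((1 - w²)⁺)²`. -/
def bump (w : ℝ) : ℝ := if |w| ≤ 1 then (1 - w ^ 2) ^ 2 else 0

lemma bump_nonneg (w : ℝ) : 0 ≤ bump w := by
  unfold bump; split_ifs <;> positivity

lemma bump_le_one (w : ℝ) : bump w ≤ 1 := by
  unfold bump
  split_ifs with h
  · have := abs_le.1 h
    have : w ^ 2 ≤ 1 := by nlinarith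
    nlinarith [sq_nonneg w]
  · norm_num

lemma measurable_bump : Measurable bump :=
  Measurable.ite (measurableSet_le (by fun_prop) (by fun_prop)) (by fun_prop) measurable_const

lemma bump_neg (w : ℝ) : bump (-w) = bump w := by simp [bump]

lemma abs_le_one_of_bump_ne_zero {w : ℝ} (h : bump w ≠ 0) : |w| ≤ 1 := by
  by_contra h1
  exact h (if_neg h1)

/-- Inside the support the exact quartic expansion loses at most `2u²`. If `w + u` leaves the
support, then `1 - w² ≤ 2|u|`, and the two terms to be absorbed are at most `4u²` and `8u²`, whence
`12`. -/
lemma le_bump_add {w : ℝ} (hw : |w| ≤ 1) (u : ℝ) :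
    bump w - 4 * w * (1 - w ^ 2) * u - 12 * u ^ 2 ≤ bump (w + u) := by
  obtain ⟨h1, h2⟩ := abs_le.1 hw
  rw [bump, if_pos hw]
  by_cases h : |w + u| ≤ 1
  · rw [bump, if_pos h]
    nlinarith [mul_nonneg (sq_nonneg u) (sq_nonneg (u + 2 * w)), mul_nonneg (sq_nonneg u) (sq_nonneg w)]
  · rw [bump, if_neg h]
    have hpos : 0 ≤ 1 - w ^ 2 := by nlinarith
    have aux : ∀ w u : ℝ, -1 ≤ w → w ≤ 1 → 1 < w + u →
        (1 - w ^ 2) ^ 2 - 4 * w * (1 - w ^ 2) * u - 12 * u ^ 2 ≤ 0 := by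
      intro w u h1 h2 h3
      have hu : 0 ≤ u := by linarith
      have hp0 : 0 ≤ 1 - w ^ 2 := by nlinarith
      have hp : 1 - w ^ 2 ≤ 2 * u := by nlinarith
      have e1 : (1 - w ^ 2) ^ 2 ≤ (2 * u) ^ 2 := pow_le_pow_left₀ hp0 hp 2
      have e2 : -w * (1 - w ^ 2) ≤ 2 * u := by nlinarith
      nlinarith
    rw [not_le, lt_abs] at h
    rcases h with h | h
    · exact aux w u h1 h2 h
    · have := aux (-w) (-u) (by linarith) (by linarith) (by linarith)
      nlinarith

/-- Near the edge the bump is too small for a quadratic loss to be absorbed as a factor. Convexity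
there (`6w² - 2 ≥ 1`) gives a quadratic gain instead. It is claimed only for inward jumps, since
outward ones may leave the support. -/
lemma le_bump_add_of_le {w : ℝ} (hw : -1 ≤ w) (hw' : w ≤ -3 / 4) (u : ℝ) :
    bump w - 4 * w * (1 - w ^ 2) * u + max u 0 ^ 2 - 6 * |u| ^ 3 ≤ bump (w + u) := by
  have hw1 : |w| ≤ 1 := by rw [abs_le]; constructor <;> linarith
  rw [bump, if_pos hw1]
  have hp0 : 0 ≤ 1 - w ^ 2 := by nlinarith
  by_cases h : |w + u| ≤ 1
  · rw [bump, if_pos h]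
    obtain ⟨h1, h2⟩ := abs_le.1 h
    rcases le_total 0 u with hu | hu
    · rw [max_eq_left hu, abs_of_nonneg hu]
      have hw2 : 1 ≤ 6 * w ^ 2 - 2 := by nlinarith
      have : 0 ≤ u ^ 2 * (6 * w ^ 2 - 2 - 1) := mul_nonneg (sq_nonneg u) (by linarith)
      have h4 : 0 ≤ u ^ 3 * (w + 1) := mul_nonneg (pow_nonneg hu 3) (by linarith)
      nlinarith [pow_nonneg hu 3, pow_nonneg hu 4]
    · rw [max_eq_right hu, abs_of_nonpos hu]
      have h4 : 0 ≤ u ^ 2 * (6 * w ^ 2 - 2) := mul_nonneg (sq_nonneg u) (by nlinarith)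
      have h5 : 0 ≤ (-u) ^ 3 * (-w) := mul_nonneg (pow_nonneg (by linarith) 3) (by linarith)
      have h6 : 0 ≤ (-u) ^ 3 := pow_nonneg (by linarith) 3
      nlinarith [sq_nonneg (u ^ 2)]
  · rw [bump, if_neg h]
    rw [not_le, lt_abs] at h
    rcases h with h | h
    · have hu : 1 ≤ u := by linarith
      rw [max_eq_left (by linarith), abs_of_nonneg (by linarith)]
      have e1 : (1 - w ^ 2) ^ 2 ≤ 1 := by nlinarith
      have e2 : -w * (1 - w ^ 2) ≤ 1 := by nlinarith
      have e3 : u ^ 2 ≤ u ^ 3 := pow_le_pow_right₀ hu (by norm_num)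
      have e4 : u ≤ u ^ 2 := by nlinarith
      nlinarith
    · have hu : u < -(1 + w) := by linarith
      rw [max_eq_right (by linarith)]
      have h6 : 0 ≤ |u| ^ 3 := by positivity
      have h7 : (1 - w ^ 2) - 4 * w * u ≤ 0 := by nlinarith
      nlinarith

lemma le_bump_of_abs_le {w : ℝ} (hw : |w| ≤ 3 / 4) : 1 / 6 ≤ bump w := by
  rw [bump, if_pos (by linarith)]
  have h1 : w ^ 2 ≤ (3 / 4) ^ 2 := sq_le_sq' (by linarith [(abs_le.1 hw).1]) (abs_le.1 hw).2
  nlinarith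

end Profiles

/-! ### One-step estimates for centred increments -/

section OneStep

variable {Ω : Type*} [MeasurableSpace Ω]

/-- Centred increments with third moment at most `M` whose positive and negative parts both have
second moment at least `v`. -/
structure Centred (Q : Measure Ω) (Z : Ω → ℝ) (v M : ℝ) : Prop where
  memLp : MemLp Z 3 Q
  mean : ∫ ω, Z ω ∂Q = 0
  third : ∫ ω, |Z ω| ^ 3 ∂Q ≤ M
  pos : v ≤ ∫ ω, max (Z ω) 0 ^ 2 ∂Q
  neg : v ≤ ∫ ω, max (-Z ω) 0 ^ 2 ∂Q

variable {Q : Measure Ω} {Z : Ω → ℝ} {v M : ℝ}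

lemma Centred.neg_centred (h : Centred Q Z v M) : Centred Q (fun ω => -Z ω) v M where
  memLp := h.memLp.neg
  mean := by rw [integral_neg, h.mean, neg_zero]
  third := by simpa only [abs_neg] using h.third
  pos := h.neg
  neg := by simpa only [neg_neg] using h.pos

lemma Centred.integrable_cube (h : Centred Q Z v M) : Integrable (fun ω => |Z ω| ^ 3) Q := by
  have := h.memLp.integrable_norm_pow (p := 3) (by norm_num)
  simpa using this

lemma Centred.integrable [IsFiniteMeasure Q] (h : Centred Q Z v M) : Integrable Z Q :=
  h.memLp.integrable (by norm_num)

lemma Centred.integrable_sq [IsFiniteMeasure Q] (h : Centred Q Z v M) :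
    Integrable (fun ω => Z ω ^ 2) Q :=
  (h.memLp.mono_exponent (by norm_num)).integrable_sq

lemma Centred.integrable_pos_sq [IsFiniteMeasure Q] (h : Centred Q Z v M) :
    Integrable (fun ω => max (Z ω) 0 ^ 2) Q := by
  refine h.integrable_sq.mono' ?_ (Filter.Eventually.of_forall fun ω => ?_)
  · exact ((h.memLp.aestronglyMeasurable.aemeasurable.max aemeasurable_const).pow_const
      2).aestronglyMeasurable
  · rw [Real.norm_eq_abs, abs_of_nonneg (by positivity)]
    rcases le_total 0 (Z ω) with hz | hz
    · rw [max_eq_left hz]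
    · rw [max_eq_right hz]; nlinarith [sq_nonneg (Z ω)]

lemma Centred.le_sq [IsFiniteMeasure Q] (h : Centred Q Z v M) : v ≤ ∫ ω, Z ω ^ 2 ∂Q := by
  refine h.pos.trans (integral_mono h.integrable_pos_sq h.integrable_sq fun ω => ?_)
  dsimp only
  rcases le_total 0 (Z ω) with hz | hz
  · rw [max_eq_left hz]
  · rw [max_eq_right hz]; nlinarith [sq_nonneg (Z ω)]

lemma Centred.sq_le [IsProbabilityMeasure Q] (h : Centred Q Z v M) :
    ∫ ω, Z ω ^ 2 ∂Q ≤ 1 + M := by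
  calc ∫ ω, Z ω ^ 2 ∂Q ≤ ∫ ω, (1 + |Z ω| ^ 3) ∂Q := by
        refine integral_mono h.integrable_sq ((integrable_const 1).add h.integrable_cube)
          fun ω => ?_
        dsimp only
        rw [← sq_abs (Z ω)]
        rcases le_total |Z ω| 1 with h1 | h1
        · have : 0 ≤ |Z ω| ^ 3 := by positivity
          nlinarith [abs_nonneg (Z ω)]
        · have := pow_le_pow_right₀ h1 (show 2 ≤ 3 by norm_num)
          linarith
    _ ≤ 1 + M := by
        rw [integral_add (integrable_const 1) h.integrable_cube]
        simpa using h.third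

lemma Centred.nonneg (h : Centred Q Z v M) : 0 ≤ M :=
  (integral_nonneg fun ω => by positivity).trans h.third

/-- Integral of a cubic-type expression in a centred variable. -/
lemma Centred.integral_taylor [IsProbabilityMeasure Q] (h : Centred Q Z v M) {W : Ω → ℝ}
    (hW : Integrable W Q) (α β γ δ ε : ℝ) :
    Integrable (fun ω => α + β * (ε * Z ω) + γ * W ω + δ * |ε * Z ω| ^ 3) Q ∧
    ∫ ω, (α + β * (ε * Z ω) + γ * W ω + δ * |ε * Z ω| ^ 3) ∂Q =
      α + γ * ∫ ω, W ω ∂Q + δ * |ε| ^ 3 * ∫ ω, |Z ω| ^ 3 ∂Q := by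
  have e : (fun ω => α + β * (ε * Z ω) + γ * W ω + δ * |ε * Z ω| ^ 3) =
      fun ω => α + (β * ε) * Z ω + γ * W ω + (δ * |ε| ^ 3) * |Z ω| ^ 3 := by
    funext ω; rw [abs_mul]; ring
  rw [e]
  have i0 : Integrable (fun _ : Ω => α) Q := integrable_const α
  have i1 := h.integrable.const_mul (β * ε)
  have i2 := hW.const_mul γ
  have i3 := h.integrable_cube.const_mul (δ * |ε| ^ 3)
  have i01 : Integrable (fun ω => α + β * ε * Z ω) Q := i0.add i1
  have i012 : Integrable (fun ω => α + β * ε * Z ω + γ * W ω) Q := i01.add i2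
  refine ⟨i012.add i3, ?_⟩
  rw [integral_add i012 i3, integral_add i01 i2, integral_add i0 i1,
    integral_const_mul, integral_const_mul, integral_const_mul, h.mean]
  simp

/-- One step of the walk killed below `0` contracts the profile `2 - e^{-x}`, up to a linear
potential. -/
lemma Centred.satProfile_step {c : ℝ} (hc : 0 < c) (hv : 0 < v) (M : ℝ) :
    ∃ l ε₀ : ℝ, 0 < l ∧ 0 < ε₀ ∧ ∀ {Ω : Type*} [MeasurableSpace Ω] (Q : Measure Ω)
      [IsProbabilityMeasure Q] (Z : Ω → ℝ), Centred Q Z v M → ∀ ε x : ℝ, 0 < ε → ε ≤ ε₀ → 0 ≤ x →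
      Real.exp (-c * ε ^ 2 * x) * ∫ ω, satProfile (x + ε * Z ω) ∂Q ≤
        Real.exp (-l * ε ^ 2) * satProfile x := by
  -- For `x ≥ 1` the potential gives `exp (-2lε²)` because `l ≤ c/2`. For `x ≤ 1` curvature gains at
  -- least `ε²v/6 ≥ 4lε²`, while the cubic error takes at most `lε²` and the claimed contraction at
  -- most `2lε²`.
  set l := min (c / 2) (v / 24) with hl
  have hl0 : 0 < l := lt_min (by linarith) (by linarith)
  -- This threshold makes the cubic error `10ε³M` at most `lε²`. The absolute value is there because
  -- `0 ≤ M` is known only once a centred variable is given.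
  refine ⟨l, l / (10 * |M| + 1), hl0, by positivity, ?_⟩
  intro Ω _ Q _ Z hZ ε x hε hε₀ hx
  have hM : 0 ≤ M := hZ.nonneg
  rw [abs_of_nonneg hM, le_div_iff₀ (by positivity)] at hε₀
  set e := Real.exp (-x) with he
  have he0 : 0 < e := Real.exp_pos _
  have he1 : e ≤ 1 := Real.exp_le_one_iff.2 (by linarith)
  obtain ⟨hint, hval⟩ := hZ.integral_taylor hZ.integrable_sq (2 - e) e (-e * ε ^ 2 / 2) 10 ε
  have hS : Integrable (fun ω => satProfile (x + ε * Z ω)) Q := by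
    refine Integrable.of_bound (C := 2) ?_ (Filter.Eventually.of_forall fun ω => ?_)
    · exact (measurable_satProfile.comp_aemeasurable
        ((hZ.integrable.aestronglyMeasurable.aemeasurable.const_mul ε).const_add
          x)).aestronglyMeasurable
    · rw [Real.norm_eq_abs, abs_of_nonneg (satProfile_nonneg _)]
      exact satProfile_le_two _
  have hI : ∫ ω, satProfile (x + ε * Z ω) ∂Q ≤ 2 - e - e * (ε ^ 2 * v / 2) + 10 * ε ^ 3 * M := by
    calc ∫ ω, satProfile (x + ε * Z ω) ∂Q
        ≤ ∫ ω, (2 - e + e * (ε * Z ω) + -e * ε ^ 2 / 2 * Z ω ^ 2 + 10 * |ε * Z ω| ^ 3) ∂Q := by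
          refine integral_mono hS hint fun ω => ?_
          have := satProfile_add_le hx (ε * Z ω)
          dsimp only
          rw [← he] at this
          nlinarith
      _ ≤ _ := by
          rw [hval, abs_of_pos hε]
          have h1 := mul_le_mul_of_nonneg_left hZ.le_sq (show 0 ≤ e * ε ^ 2 / 2 by positivity)
          have h2 := mul_le_mul_of_nonneg_left hZ.third (show 0 ≤ 10 * ε ^ 3 by positivity)
          nlinarith
  have hG : satProfile x = 2 - e := satProfile_of_nonneg hx
  set I := ∫ ω, satProfile (x + ε * Z ω) ∂Q with hIdef
  have hε3 : 10 * ε ^ 3 * M ≤ l * ε ^ 2 := by nlinarith [sq_nonneg ε, mul_nonneg hM hε.le]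
  have hw : Real.exp (-c * ε ^ 2 * x) ≤ 1 := Real.exp_le_one_iff.2 (by
    have : 0 ≤ c * ε ^ 2 * x := by positivity
    linarith)
  have hw0 := Real.exp_pos (-c * ε ^ 2 * x)
  have hI0 : 0 ≤ I := integral_nonneg fun ω => satProfile_nonneg _
  rw [hG]
  have hG1 : 1 ≤ 2 - e := by linarith
  -- Far from the obstacle half of the gain from the potential pays for the cubic error; close to it
  -- the potential is discarded and concavity suffices.
  rcases le_total 1 x with h1 | h1
  · have e1 : I ≤ (2 - e) * Real.exp (l * ε ^ 2) := by
      have : l * ε ^ 2 + 1 ≤ Real.exp (l * ε ^ 2) := Real.add_one_le_exp _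
      have h3 : 0 ≤ e * (ε ^ 2 * v / 2) := by positivity
      have h4 : 0 ≤ l * ε ^ 2 := by positivity
      nlinarith
    have e2 : Real.exp (-c * ε ^ 2 * x) ≤ Real.exp (-2 * l * ε ^ 2) := by
      refine Real.exp_le_exp.2 ?_
      have : l ≤ c / 2 := min_le_left _ _
      have h5 : 0 ≤ ε ^ 2 * (c * x - 2 * l) := mul_nonneg (sq_nonneg ε) (by nlinarith)
      nlinarith
    calc Real.exp (-c * ε ^ 2 * x) * I
        ≤ Real.exp (-2 * l * ε ^ 2) * ((2 - e) * Real.exp (l * ε ^ 2)) :=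
          mul_le_mul e2 e1 hI0 (Real.exp_pos _).le
      _ = (Real.exp (-2 * l * ε ^ 2) * Real.exp (l * ε ^ 2)) * (2 - e) := by ring
      _ = _ := by rw [← Real.exp_add]; ring_nf
  · have e3 : 1 / 3 ≤ e := by
      have h3 : Real.exp (-1) ≤ e := Real.exp_le_exp.2 (by linarith)
      have h4 : Real.exp 1 < 3 := Real.exp_one_lt_three
      have h5 : 1 / 3 ≤ Real.exp (-1) := by
        rw [Real.exp_neg, one_div]
        exact inv_anti₀ (Real.exp_pos 1) h4.le
      linarith
    have hlv : l ≤ v / 24 := min_le_right _ _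
    have e4 : I ≤ (2 - e) * (1 - l * ε ^ 2) := by
      have h6 : ε ^ 2 * (v / 6) ≤ e * (ε ^ 2 * v / 2) := by
        have : 0 ≤ ε ^ 2 * v / 2 := by positivity
        nlinarith
      have h7 : l * ε ^ 2 ≤ v / 24 * ε ^ 2 := mul_le_mul_of_nonneg_right hlv (sq_nonneg ε)
      have h8 : 0 ≤ l * ε ^ 2 := by positivity
      nlinarith
    calc Real.exp (-c * ε ^ 2 * x) * I ≤ 1 * I := mul_le_mul_of_nonneg_right hw hI0
      _ ≤ (1 - l * ε ^ 2) * (2 - e) := by linarith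
      _ ≤ _ := by
        refine mul_le_mul_of_nonneg_right ?_ (by linarith)
        have := Real.add_one_le_exp (-l * ε ^ 2)
        linarith

/-- One step of the walk almost preserves the bump. -/
lemma Centred.bump_step (hv : 0 < v) (M : ℝ) :
    ∃ l ε₀ : ℝ, 0 < l ∧ 0 < ε₀ ∧ ∀ {Ω : Type*} [MeasurableSpace Ω] (Q : Measure Ω)
      [IsProbabilityMeasure Q] (Z : Ω → ℝ), Centred Q Z v M → ∀ ε w : ℝ, 0 < ε → ε ≤ ε₀ →
      Real.exp (-l * ε ^ 2) * bump w ≤ ∫ ω, bump (w + ε * Z ω) ∂Q := by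
  -- In the bulk `bump ≥ 1/6`, so the loss `12ε²(1 + M)` is absorbed when `(lε²/2)/6` equals it.
  set l := 144 * (1 + |M|) with hl
  have hl0 : 0 < l := by positivity
  -- The first threshold lets the edge gain `ε²v` dominate the cubic error `6ε³M`; the second gives
  -- `lε² ≤ 1`, hence `exp (-lε²) ≤ 1 - lε²/2`.
  refine ⟨l, min (v / (6 * |M| + 1)) (1 / l), hl0, by positivity, ?_⟩
  intro Ω _ Q _ Z hZ ε w hε hε₀
  have hM : 0 ≤ M := hZ.nonneg
  rw [abs_of_nonneg hM] at hl hε₀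
  have hε1 := hε₀.trans (min_le_left _ _)
  have hε2 := hε₀.trans (min_le_right _ _)
  rw [le_div_iff₀ (by positivity)] at hε1 hε2
  have hl1 : 1 ≤ l := by rw [hl]; linarith
  have hεone : ε ≤ 1 := by nlinarith
  have hlε : l * ε ^ 2 ≤ 1 := by nlinarith
  have hint : ∀ (Z : Ω → ℝ), Centred Q Z v M → ∀ w, Integrable (fun ω => bump (w + ε * Z ω)) Q := by
    intro Z hZ w
    refine Integrable.of_bound (C := 1) ?_ (Filter.Eventually.of_forall fun ω => ?_)
    · exact (measurable_bump.comp_aemeasurable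
        ((hZ.integrable.aestronglyMeasurable.aemeasurable.const_mul ε).const_add
          w)).aestronglyMeasurable
    · rw [Real.norm_eq_abs, abs_of_nonneg (bump_nonneg _)]
      exact bump_le_one _
  have hexp1 : Real.exp (-l * ε ^ 2) ≤ 1 := Real.exp_le_one_iff.2 (by
    have : 0 ≤ l * ε ^ 2 := by positivity
    linarith)
  have hedge : ∀ (Z : Ω → ℝ), Centred Q Z v M → ∀ w, -1 ≤ w → w ≤ -3 / 4 →
      bump w ≤ ∫ ω, bump (w + ε * Z ω) ∂Q := by
    intro Z hZ w h1 h2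
    obtain ⟨hi, hval⟩ := hZ.integral_taylor hZ.integrable_pos_sq (bump w) (-4 * w * (1 - w ^ 2))
      (ε ^ 2) (-6) ε
    calc bump w ≤ ∫ ω, (bump w + -4 * w * (1 - w ^ 2) * (ε * Z ω) + ε ^ 2 * max (Z ω) 0 ^ 2
          + -6 * |ε * Z ω| ^ 3) ∂Q := by
          rw [hval, abs_of_pos hε]
          have e1 := mul_le_mul_of_nonneg_left hZ.pos (sq_nonneg ε)
          have e2 := mul_le_mul_of_nonneg_left hZ.third (show 0 ≤ 6 * ε ^ 3 by positivity)
          have e3 : 6 * ε ^ 3 * M ≤ ε ^ 2 * v := by nlinarith [sq_nonneg ε]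
          linarith
      _ ≤ _ := by
          refine integral_mono hi (hint Z hZ w) fun ω => ?_
          have := le_bump_add_of_le h1 h2 (ε * Z ω)
          have e4 : max (ε * Z ω) 0 = ε * max (Z ω) 0 := by
            rw [mul_max_of_nonneg _ _ hε.le, mul_zero]
          rw [e4, mul_pow] at this
          dsimp only
          linarith
  by_cases hw : |w| ≤ 1
  swap
  · rw [bump, if_neg hw, mul_zero]
    exact integral_nonneg fun ω => bump_nonneg _
  obtain ⟨hw1, hw2⟩ := abs_le.1 hw
  by_cases h34 : |w| ≤ 3 / 4
  · obtain ⟨hi, hval⟩ := hZ.integral_taylor hZ.integrable_sq (bump w) (-4 * w * (1 - w ^ 2))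
      (-12 * ε ^ 2) 0 ε
    have hb := le_bump_of_abs_le h34
    calc Real.exp (-l * ε ^ 2) * bump w ≤ bump w - 12 * ε ^ 2 * (1 + M) := by
          have e1 : Real.exp (-l * ε ^ 2) ≤ 1 - l * ε ^ 2 / 2 := by
            have hs : 0 ≤ l * ε ^ 2 := by positivity
            have e2 := Real.add_one_le_exp (l * ε ^ 2)
            rw [neg_mul, Real.exp_neg, inv_le_comm₀ (Real.exp_pos _) (by linarith)]
            refine le_trans ?_ e2
            rw [inv_le_iff_one_le_mul₀ (by linarith)]
            nlinarith
          have e3 : 0 ≤ l * ε ^ 2 / 2 := by positivity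
          have e4 : l * ε ^ 2 / 2 * (1 / 6) = 12 * ε ^ 2 * (1 + M) := by rw [hl]; ring
          nlinarith [mul_le_mul_of_nonneg_left hb e3]
      _ ≤ ∫ ω, (bump w + -4 * w * (1 - w ^ 2) * (ε * Z ω) + -12 * ε ^ 2 * Z ω ^ 2
            + 0 * |ε * Z ω| ^ 3) ∂Q := by
          rw [hval]
          have := mul_le_mul_of_nonneg_left hZ.sq_le (show 0 ≤ 12 * ε ^ 2 by positivity)
          linarith
      _ ≤ _ := by
          refine integral_mono hi (hint Z hZ w) fun ω => ?_
          have := le_bump_add hw (ε * Z ω)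
          dsimp only
          nlinarith
  · refine (mul_le_of_le_one_left (bump_nonneg w) hexp1).trans ?_
    rw [not_le, lt_abs] at h34
    rcases h34 with h | h
    -- The right edge is the left edge for the reflected variable, since the bump is even.
    · have := hedge _ hZ.neg_centred (-w) (by linarith) (by linarith)
      rw [bump_neg] at this
      refine this.trans (le_of_eq (integral_congr_ae (Filter.Eventually.of_forall fun ω => ?_)))
      dsimp only
      rw [← bump_neg]
      ring_nf
    · exact hedge Z hZ w hw1 (by linarith)

end OneStep

/-! ### Exponential tilting, the rate function and uniform moments -/

section Tilt

variable {Ω : Type*} [MeasurableSpace Ω] {P : Measure Ω} {Y : Ω → ℝ}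

lemma mem_interior_of_lt {t : ℝ} (h1 : lowerTilt Y P < (t : EReal))
    (h2 : (t : EReal) < upperTilt Y P) : t ∈ interior (integrableExpSet Y P) := by
  obtain ⟨_, ⟨u, hu, rfl⟩, hut⟩ := sInf_lt_iff.1 h1
  obtain ⟨_, ⟨w, hw, rfl⟩, htw⟩ := lt_sSup_iff.1 h2
  have hut' : u < t := EReal.coe_lt_coe_iff.1 hut
  have htw' : t < w := EReal.coe_lt_coe_iff.1 htw
  refine mem_interior.2 ⟨Set.Ioo u w, fun s hs => ?_, isOpen_Ioo, ⟨hut', htw'⟩⟩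
  exact convex_integrableExpSet.ordConnected.out hu hw ⟨hs.1.le, hs.2.le⟩

lemma exp_cgf_eq [IsProbabilityMeasure P] {t : ℝ} (ht : t ∈ integrableExpSet Y P) :
    Real.exp (cgf Y P t) = mgf Y P t := exp_cgf ht

/-- The cumulant generating function lies above its tangents. -/
lemma cgf_tangent [IsProbabilityMeasure P] {t t' : ℝ} (ht : t ∈ interior (integrableExpSet Y P))
    (ht' : t' ∈ integrableExpSet Y P) :
    cgf Y P t + (t' - t) * deriv (cgf Y P) t ≤ cgf Y P t' := by
  have hti := interior_subset ht
  set μ := deriv (cgf Y P) t with hμ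
  have hm : 0 < mgf Y P t := mgf_pos hti
  have hYi : Integrable (fun ω => Y ω * Real.exp (t * Y ω)) P := by
    simpa using integrable_pow_mul_exp_of_mem_interior_integrableExpSet ht 1
  have hYe : ∫ ω, Y ω * Real.exp (t * Y ω) ∂P = μ * mgf Y P t := by
    rw [hμ, deriv_cgf ht, div_mul_cancel₀ _ hm.ne']
  -- Pointwise, `e^{t'Y} ≥ e^{(t'-t)μ} e^{tY} (1 + (t'-t)(Y - μ))`; the linear term integrates to
  -- zero because `μ` is the tilted mean.
  have h1 : ∫ ω, Real.exp ((t' - t) * μ) * (Real.exp (t * Y ω) + (t' - t) *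
      (Y ω * Real.exp (t * Y ω) - μ * Real.exp (t * Y ω))) ∂P ≤ mgf Y P t' := by
    refine integral_mono ((hti.add ((hYi.sub (hti.const_mul μ)).const_mul _)).const_mul _) ht'
      fun ω => ?_
    have h2 := Real.add_one_le_exp ((t' - t) * (Y ω - μ))
    have h3 : Real.exp (t' * Y ω) = Real.exp ((t' - t) * μ) * (Real.exp (t * Y ω) *
        Real.exp ((t' - t) * (Y ω - μ))) := by
      rw [← Real.exp_add, ← Real.exp_add]; ring_nf
    dsimp only
    rw [h3]
    refine mul_le_mul_of_nonneg_left ?_ (Real.exp_pos _).le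
    nlinarith [mul_le_mul_of_nonneg_left h2 (Real.exp_pos (t * Y ω)).le]
  have hsub : Integrable (fun ω => (t' - t) * (Y ω * Real.exp (t * Y ω) -
      μ * Real.exp (t * Y ω))) P := (hYi.sub (hti.const_mul μ)).const_mul _
  rw [integral_const_mul, integral_add hti hsub, integral_const_mul,
    integral_sub hYi (hti.const_mul μ), integral_const_mul, hYe] at h1
  change Real.exp ((t' - t) * μ) * (mgf Y P t + (t' - t) * (μ * mgf Y P t - μ * mgf Y P t)) ≤ _ at h1
  rw [sub_self, mul_zero, add_zero, ← exp_cgf_eq hti, ← exp_cgf_eq ht', ← Real.exp_add] at h1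
  linarith [Real.exp_le_exp.1 h1]

/-- The inequality between `H` and its tangent at `t` says exactly that `t` is optimal for the slope
`x = H'(t)`. -/
lemma isGreatest_legendreValues [IsProbabilityMeasure P] {t : ℝ} (h1 : lowerTilt Y P < (t : EReal))
    (h2 : (t : EReal) < upperTilt Y P) {x : ℝ} (hx : deriv (cgf Y P) t = x) :
    IsGreatest (legendreValues Y P x) (t * x - cgf Y P t) := by
  refine ⟨⟨t, h1, h2, rfl⟩, ?_⟩
  rintro _ ⟨t', h1', h2', rfl⟩
  have := cgf_tangent (mem_interior_of_lt h1 h2) (interior_subset (mem_interior_of_lt h1' h2'))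
  rw [hx] at this
  linarith

lemma rate_eq [IsProbabilityMeasure P] {t : ℝ} (h1 : lowerTilt Y P < (t : EReal))
    (h2 : (t : EReal) < upperTilt Y P) {x : ℝ} (hx : deriv (cgf Y P) t = x) :
    rate Y P x = t * x - cgf Y P t :=
  (isGreatest_legendreValues h1 h2 hx).csSup_eq

lemma le_rate [IsProbabilityMeasure P] {t : ℝ} (h1 : lowerTilt Y P < (t : EReal))
    (h2 : (t : EReal) < upperTilt Y P) {x : ℝ} (hx : BddAbove (legendreValues Y P x)) :
    t * x - cgf Y P t ≤ rate Y P x :=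
  le_csSup hx ⟨t, h1, h2, rfl⟩

/-- `H''(t)` is the variance under the tilted law. If it vanished, `Y` would be constant almost
surely for that law, hence also for `P`, which is absolutely continuous with respect to it. -/
lemma iteratedDeriv_two_cgf_pos [IsProbabilityMeasure P] {t : ℝ}
    (ht : t ∈ interior (integrableExpSet Y P)) (hY : ∀ c : ℝ, ¬ ∀ᵐ ω ∂P, Y ω = c) :
    0 < iteratedDeriv 2 (cgf Y P) t := by
  have hti : t ∈ integrableExpSet Y P := interior_subset ht
  have := isProbabilityMeasure_tilted hti
  rw [← variance_tilted_mul ht]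
  refine lt_of_le_of_ne (variance_nonneg _ _) fun h0 => ?_
  have hL : MemLp Y 2 (P.tilted (t * Y ·)) := by
    simpa using memLp_tilted_mul ht 2
  have h1 := ae_eq_integral_of_variance_eq_zero hL h0.symm
  exact hY _ ((absolutelyContinuous_tilted hti).ae_le h1)

/-- The derivative of the cumulant generating function is bi-Lipschitz on compact intervals. -/
lemma exists_deriv_cgf_bounds [IsProbabilityMeasure P] {a b : ℝ} (hab : a ≤ b)
    (hI : Set.Icc a b ⊆ interior (integrableExpSet Y P)) (hY : ∀ c : ℝ, ¬ ∀ᵐ ω ∂P, Y ω = c) :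
    ∃ κ κ' : ℝ, 0 < κ ∧ 0 < κ' ∧ ∀ s ∈ Set.Icc a b, ∀ t ∈ Set.Icc a b, s ≤ t →
      κ * (t - s) ≤ deriv (cgf Y P) t - deriv (cgf Y P) s ∧
      deriv (cgf Y P) t - deriv (cgf Y P) s ≤ κ' * (t - s) := by
  have hA : AnalyticOnNhd ℝ (cgf Y P) (Set.Icc a b) := fun t ht => analyticAt_cgf (hI ht)
  have hA1 : AnalyticOnNhd ℝ (deriv (cgf Y P)) (Set.Icc a b) := hA.deriv
  have hc : ContinuousOn (deriv (deriv (cgf Y P))) (Set.Icc a b) := hA1.deriv.continuousOn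
  have hpos : ∀ t ∈ Set.Icc a b, 0 < deriv (deriv (cgf Y P)) t := by
    intro t ht
    have := iteratedDeriv_two_cgf_pos (hI ht) hY
    rwa [iteratedDeriv_succ, iteratedDeriv_one] at this
  obtain ⟨x, hx, hmin⟩ := isCompact_Icc.exists_isMinOn (Set.nonempty_Icc.2 hab) hc
  obtain ⟨y, hy, hmax⟩ := isCompact_Icc.exists_isMaxOn (Set.nonempty_Icc.2 hab) hc
  refine ⟨_, _, hpos x hx, hpos y hy, fun s hs t ht hst => ?_⟩
  rcases hst.eq_or_lt with rfl | hst
  · simp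
  have hsub : Set.Icc s t ⊆ Set.Icc a b := Set.Icc_subset_Icc hs.1 ht.2
  obtain ⟨c, hc', hceq⟩ := exists_deriv_eq_slope (deriv (cgf Y P)) hst
    (hA1.continuousOn.mono hsub)
    (fun u hu => (hA1 u (hsub (Set.Ioo_subset_Icc_self hu))).differentiableAt.differentiableWithinAt)
  have hcm := hsub (Set.Ioo_subset_Icc_self hc')
  have hts : 0 < t - s := by linarith
  rw [eq_div_iff hts.ne'] at hceq
  rw [← hceq]
  exact ⟨mul_le_mul_of_nonneg_right (hmin hcm) hts.le, mul_le_mul_of_nonneg_right (hmax hcm) hts.le⟩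

/-- A non-degenerate variable charges values on both sides of its tilted means. -/
lemma exists_atom_gt [IsProbabilityMeasure P] {ξ : Ω → ℤ} {t : ℝ} {s : ℝ}
    (ht : t ∈ interior (integrableExpSet (fun ω => (ξ ω : ℝ)) P))
    (hY : ∀ c : ℝ, ¬ ∀ᵐ ω ∂P, (ξ ω : ℝ) = c) (hs : s ≠ 0) :
    ∃ j : ℤ, 0 < P {ω | ξ ω = j} ∧ 0 < s * (j - deriv (cgf (fun ω => (ξ ω : ℝ)) P) t) := by
  set Y : Ω → ℝ := fun ω => (ξ ω : ℝ) with hYdef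
  set μ := deriv (cgf Y P) t with hμ
  by_contra! hcon
  have hti : t ∈ integrableExpSet Y P := interior_subset ht
  have := isProbabilityMeasure_tilted hti
  -- If every atom lay on one side of `μ`, a variable of constant sign would have tilted mean zero,
  -- and `Y` would be constant.
  have hle : ∀ᵐ ω ∂P, s * (Y ω - μ) ≤ 0 := by
    filter_upwards [ae_atom_pos (P := P) (ξ := ξ)] with ω hω
    exact hcon _ hω
  have hle' : ∀ᵐ ω ∂(P.tilted (t * Y ·)), 0 ≤ s * (μ - Y ω) := by
    filter_upwards [(tilted_absolutelyContinuous P (t * Y ·)).ae_le hle] with ω hω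
    linarith
  have hint : Integrable Y (P.tilted (t * Y ·)) := by
    have := memLp_tilted_mul ht 1
    simpa using (memLp_one_iff_integrable.1 (by simpa using this))
  have h0 : ∫ ω, s * (μ - Y ω) ∂(P.tilted (t * Y ·)) = 0 := by
    rw [integral_const_mul, integral_sub (integrable_const _) hint, integral_tilted_mul_self ht]
    simp [hμ]
  have h1 := (integral_eq_zero_iff_of_nonneg_ae hle'
    (((integrable_const μ).sub hint).const_mul s)).1 h0
  refine hY μ ((absolutelyContinuous_tilted hti).ae_le ?_)
  filter_upwards [h1] with ω hω
  simp only [Pi.zero_apply, mul_eq_zero, hs, false_or] at hω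
  change Y ω = μ
  linarith

/-- The tangent of `H` at `0` is the zero line, the mean being zero. -/
lemma cgf_nonneg [IsProbabilityMeasure P] {t : ℝ}
    (h0 : (0 : ℝ) ∈ interior (integrableExpSet Y P)) (ht : t ∈ integrableExpSet Y P)
    (hmean : ∫ ω, Y ω ∂P = 0) : 0 ≤ cgf Y P t := by
  have := cgf_tangent h0 ht
  rw [deriv_cgf_zero h0, hmean] at this
  simpa using this

/-- Keeping a single atom of a nonnegative integral gives an explicit lower bound, from which the
one-sided second moments are bounded below uniformly in the tilt. -/
lemma atom_tilted_le [IsProbabilityMeasure P] {ξ : Ω → ℤ} (hξ : Measurable ξ) {t : ℝ}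
    (ht : t ∈ integrableExpSet (fun ω => (ξ ω : ℝ)) P) (j : ℤ) {F : ℤ → ℝ} (hF : ∀ x, 0 ≤ F x)
    (hFi : Integrable (fun ω => F (ξ ω)) (P.tilted (fun ω => t * (ξ ω : ℝ)))) :
    Real.exp (t * j - cgf (fun ω => (ξ ω : ℝ)) P t) * P.real {ω | ξ ω = j} * F j ≤
      ∫ ω, F (ξ ω) ∂(P.tilted (fun ω => t * (ξ ω : ℝ))) := by
  have hm : MeasurableSet {ω | ξ ω = j} := hξ (measurableSet_singleton j)
  have h1 : ∫ ω in {ω | ξ ω = j}, F (ξ ω) ∂(P.tilted (fun ω => t * (ξ ω : ℝ))) =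
      Real.exp (t * j - cgf (fun ω => (ξ ω : ℝ)) P t) * P.real {ω | ξ ω = j} * F j := by
    rw [setIntegral_tilted_mul_eq_cgf (X := fun ω => (ξ ω : ℝ)) _ _ ht]
    rw [setIntegral_congr_fun (g := fun _ =>
      Real.exp (t * j - cgf (fun ω => (ξ ω : ℝ)) P t) * F j) hm]
    · rw [setIntegral_const, smul_eq_mul]; ring
    · intro ω hω
      have hω' : ξ ω = j := hω
      simp only [hω', smul_eq_mul]
  rw [← h1]
  exact setIntegral_le_integral hFi (Filter.Eventually.of_forall fun ω => hF _)

/-- A bound for the third moments of the tilted variables, uniform in the tilt. -/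
lemma third_moment_tilted_le [IsProbabilityMeasure P] {a b : ℝ}
    (hI : Set.Icc a b ⊆ interior (integrableExpSet Y P))
    (h0 : (0 : ℝ) ∈ interior (integrableExpSet Y P)) (hmean : ∫ ω, Y ω ∂P = 0)
    {t : ℝ} (ht : t ∈ Set.Icc a b) {μ B : ℝ} (hμB : |μ| ≤ B) :
    ∫ ω, |Y ω - μ| ^ 3 ∂(P.tilted (fun ω => t * Y ω)) ≤
      4 * (∫ ω, |Y ω| ^ 3 * Real.exp (a * Y ω) ∂P + ∫ ω, |Y ω| ^ 3 * Real.exp (b * Y ω) ∂P)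
        + 4 * B ^ 3 := by
  have hab : a ≤ b := ht.1.trans ht.2
  have hti : t ∈ integrableExpSet Y P := interior_subset (hI ht)
  have hi3 : ∀ t ∈ Set.Icc a b, Integrable (fun ω => |Y ω| ^ 3 * Real.exp (t * Y ω)) P :=
    fun t ht => integrable_pow_abs_mul_exp_of_mem_interior_integrableExpSet (hI ht) 3
  have ha := hi3 a ⟨le_rfl, hab⟩
  have hb := hi3 b ⟨hab, le_rfl⟩
  have : IsProbabilityMeasure (P.tilted (fun ω => t * Y ω)) := isProbabilityMeasure_tilted hti
  have hL : MemLp Y 3 (P.tilted (fun ω => t * Y ω)) := by simpa using memLp_tilted_mul (hI ht) 3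
  have e1 : ∀ ω, |Y ω - μ| ^ 3 ≤ 4 * |Y ω| ^ 3 + 4 * B ^ 3 := by
    intro ω
    have h3 : |Y ω - μ| ≤ |Y ω| + B := (abs_sub _ _).trans (by linarith)
    have h4 := pow_le_pow_left₀ (abs_nonneg _) h3 3
    have h5 : 0 ≤ B := (abs_nonneg μ).trans hμB
    have h6 := abs_nonneg (Y ω)
    nlinarith [mul_nonneg (add_nonneg h6 h5) (sq_nonneg (|Y ω| - B))]
  have hi : Integrable (fun ω => 4 * |Y ω| ^ 3) (P.tilted (fun ω => t * Y ω)) := by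
    simpa using (hL.integrable_norm_pow (p := 3) (by norm_num)).const_mul 4
  have hi' : Integrable (fun ω => 4 * |Y ω| ^ 3 + 4 * B ^ 3) (P.tilted (fun ω => t * Y ω)) :=
    hi.add (integrable_const _)
  have e2 : ∫ ω, |Y ω| ^ 3 ∂(P.tilted (fun ω => t * Y ω)) ≤
      ∫ ω, |Y ω| ^ 3 * Real.exp (a * Y ω) ∂P + ∫ ω, |Y ω| ^ 3 * Real.exp (b * Y ω) ∂P := by
    rw [integral_tilted_mul_eq_cgf _ hti, ← integral_add ha hb]
    refine integral_mono_of_nonneg (Filter.Eventually.of_forall fun ω => ?_)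
      (ha.add hb) (Filter.Eventually.of_forall fun ω => ?_)
    · exact mul_nonneg (Real.exp_pos _).le (by positivity)
    have hc : 0 ≤ cgf Y P t := cgf_nonneg h0 hti hmean
    -- Nonnegativity of `H` disposes of the normalisation, and `e^{tY}` is dominated by the two
    -- extreme tilts.
    have e3 : Real.exp (t * Y ω - cgf Y P t) ≤ Real.exp (a * Y ω) + Real.exp (b * Y ω) := by
      refine (Real.exp_le_exp.2 (by linarith : _ ≤ t * Y ω)).trans ?_
      rcases le_total 0 (Y ω) with hy | hy
      · have := Real.exp_le_exp.2 (mul_le_mul_of_nonneg_right ht.2 hy)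
        linarith [Real.exp_pos (a * Y ω)]
      · have := Real.exp_le_exp.2 (mul_le_mul_of_nonpos_right ht.1 hy)
        linarith [Real.exp_pos (b * Y ω)]
    have e4 := mul_le_mul_of_nonneg_left e3 (show 0 ≤ |Y ω| ^ 3 by positivity)
    simp only [smul_eq_mul]
    linarith
  calc ∫ ω, |Y ω - μ| ^ 3 ∂(P.tilted (fun ω => t * Y ω))
      ≤ ∫ ω, (4 * |Y ω| ^ 3 + 4 * B ^ 3) ∂(P.tilted (fun ω => t * Y ω)) :=
        integral_mono_of_nonneg (Filter.Eventually.of_forall fun ω => by positivity) hi'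
          (Filter.Eventually.of_forall e1)
    _ ≤ _ := by
        rw [integral_add hi (integrable_const _), integral_const_mul, integral_const]
        simp only [probReal_univ, one_smul]
        linarith

/-- Uniform moment bounds for the centred tilted increments. -/
lemma exists_centred_tilted [IsProbabilityMeasure P] {ξ : Ω → ℤ} (hξ : Measurable ξ) {a b : ℝ}
    (hI : Set.Icc a b ⊆ interior (integrableExpSet (fun ω => (ξ ω : ℝ)) P)) (hab : a ≤ b)
    (h0 : (0 : ℝ) ∈ interior (integrableExpSet (fun ω => (ξ ω : ℝ)) P))
    (hmean : ∫ ω, (ξ ω : ℝ) ∂P = 0)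
    {jp jm : ℤ} (hjp : 0 < P {ω | ξ ω = jp}) (hjm : 0 < P {ω | ξ ω = jm}) {μl μu : ℝ}
    (hu : μu < jp) (hl : jm < μl) :
    ∃ v M : ℝ, 0 < v ∧ ∀ t ∈ Set.Icc a b, ∀ μ, deriv (cgf (fun ω => (ξ ω : ℝ)) P) t = μ →
      μl ≤ μ → μ ≤ μu → Centred (P.tilted (fun ω => t * (ξ ω : ℝ))) (fun ω => ξ ω - μ) v M := by
  set Y : Ω → ℝ := fun ω => (ξ ω : ℝ) with hY
  have hYm : Measurable Y := (measurable_ofInt _).comp hξ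
  have hcc : ContinuousOn (cgf Y P) (Set.Icc a b) := fun t ht =>
    (analyticAt_cgf (hI ht)).continuousAt.continuousWithinAt
  obtain ⟨w, -, hw⟩ := isCompact_Icc.exists_isMaxOn (Set.nonempty_Icc.2 hab) hcc
  set H := cgf Y P w with hH
  set A := max |a| |b| with hA
  have htA : ∀ t ∈ Set.Icc a b, |t| ≤ A := fun t ht => abs_le_max_abs_abs ht.1 ht.2
  have hpos : ∀ j : ℤ, 0 < P {ω | ξ ω = j} → 0 < P.real {ω | ξ ω = j} := fun j hj =>
    ENNReal.toReal_pos hj.ne' (measure_ne_top _ _)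
  set B := max |μl| |μu| with hB
  set M := 4 * (∫ ω, |Y ω| ^ 3 * Real.exp (a * Y ω) ∂P + ∫ ω, |Y ω| ^ 3 * Real.exp (b * Y ω) ∂P)
    + 4 * B ^ 3 with hM
  have hatom : ∀ t ∈ Set.Icc a b, ∀ j : ℤ, Real.exp (-(A * |(j : ℝ)|) - H) ≤
      Real.exp (t * j - cgf Y P t) := by
    intro t ht j
    refine Real.exp_le_exp.2 ?_
    have h1 : cgf Y P t ≤ H := hw ht
    have h2 : |t * j| ≤ A * |(j : ℝ)| := by
      rw [abs_mul]; exact mul_le_mul_of_nonneg_right (htA t ht) (abs_nonneg _)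
    linarith [neg_abs_le (t * j)]
  -- Each one-sided second moment is bounded below by the contribution of one atom lying strictly
  -- beyond all the means; `H` bounds the cumulant generating function over all tilts.
  refine ⟨min (Real.exp (-(A * |(jp : ℝ)|) - H) * P.real {ω | ξ ω = jp} * (jp - μu) ^ 2)
    (Real.exp (-(A * |(jm : ℝ)|) - H) * P.real {ω | ξ ω = jm} * (μl - jm) ^ 2), M, ?_, ?_⟩
  · have := hpos jp hjp
    have := hpos jm hjm
    have : 0 < jp - μu := by linarith
    have : 0 < μl - jm := by linarith
    exact lt_min (by positivity) (by positivity)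
  intro t ht μ hμ h1 h2
  have hti : t ∈ integrableExpSet Y P := interior_subset (hI ht)
  set Q := P.tilted (fun ω => t * Y ω) with hQ
  have : IsProbabilityMeasure Q := isProbabilityMeasure_tilted hti
  have hL : MemLp Y 3 Q := by simpa using memLp_tilted_mul (hI ht) 3
  have hL' : MemLp (fun ω => Y ω - μ) 3 Q := hL.sub (memLp_const μ)
  have hYint : Integrable Y Q := hL.integrable (by norm_num)
  have hsq : Integrable (fun ω => (Y ω - μ) ^ 2) Q :=
    (hL'.mono_exponent (by norm_num)).integrable_sq
  have hμB : |μ| ≤ B := abs_le_max_abs_abs h1 h2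
  have hsqF : ∀ (s : ℝ), |s| = 1 → Integrable (fun ω => max (s * (Y ω - μ)) 0 ^ 2) Q := by
    intro s hs
    refine hsq.mono' ?_ (Filter.Eventually.of_forall fun ω => ?_)
    · exact Measurable.aestronglyMeasurable (by fun_prop)
    · rw [Real.norm_eq_abs, abs_of_nonneg (by positivity)]
      have : (Y ω - μ) ^ 2 = (s * (Y ω - μ)) ^ 2 := by
        rw [mul_pow, ← sq_abs s, hs]; ring
      rw [this]
      rcases le_total 0 (s * (Y ω - μ)) with hz | hz
      · rw [max_eq_left hz]
      · rw [max_eq_right hz]; nlinarith [sq_nonneg (s * (Y ω - μ))]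
  refine ⟨hL', ?_, ?_, ?_, ?_⟩
  · rw [integral_sub hYint (integrable_const μ), integral_tilted_mul_self (hI ht), hμ]
    simp
  · exact third_moment_tilted_le hI h0 hmean ht hμB
  · refine (min_le_left _ _).trans ?_
    have h3 := atom_tilted_le hξ hti jp (F := fun x => max (1 * ((x : ℝ) - μ)) 0 ^ 2)
      (fun x => by positivity) (hsqF 1 (by simp))
    simp only [one_mul] at h3
    refine le_trans ?_ h3
    rw [max_eq_left (by linarith)]
    have h4 : (jp - μu) ^ 2 ≤ ((jp : ℝ) - μ) ^ 2 := pow_le_pow_left₀ (by linarith) (by linarith) 2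
    have h5 := hatom t ht jp
    exact mul_le_mul (mul_le_mul_of_nonneg_right h5 measureReal_nonneg) h4 (sq_nonneg _)
      (mul_nonneg (Real.exp_pos _).le measureReal_nonneg)
  · refine (min_le_right _ _).trans ?_
    have h3 := atom_tilted_le hξ hti jm (F := fun x => max (-1 * ((x : ℝ) - μ)) 0 ^ 2)
      (fun x => by positivity) (hsqF (-1) (by simp))
    simp only [neg_one_mul] at h3
    refine le_trans ?_ h3
    rw [max_eq_left (by linarith)]
    have h4 : (μl - jm) ^ 2 ≤ (-((jm : ℝ) - μ)) ^ 2 := pow_le_pow_left₀ (by linarith) (by linarith) 2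
    have h5 := hatom t ht jm
    exact mul_le_mul (mul_le_mul_of_nonneg_right h5 measureReal_nonneg) h4 (sq_nonneg _)
      (mul_nonneg (Real.exp_pos _).le measureReal_nonneg)

end Tilt

/-! ### Increments of the obstacle and Riemann sums -/

section Obstacle

lemma uniqueDiffOn_unit : UniqueDiffOn ℝ (Set.Icc (0 : ℝ) 1) := uniqueDiffOn_Icc zero_lt_one

lemma hasDerivAt_unitDeriv {f : ℝ → ℝ} (hf : DifferentiableOn ℝ f (Set.Icc 0 1)) {x : ℝ}
    (hx : x ∈ Set.Ioo (0 : ℝ) 1) : HasDerivAt f (unitDeriv f x) x :=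
  ((hf x (Set.Ioo_subset_Icc_self hx)).hasDerivWithinAt).hasDerivAt
    (Icc_mem_nhds hx.1 hx.2)

/-- The mean value theorem for the derivative on the unit interval. -/
lemma exists_unitDeriv_eq_slope {f : ℝ → ℝ} (hf : DifferentiableOn ℝ f (Set.Icc 0 1)) {x y : ℝ}
    (hx : 0 ≤ x) (hxy : x < y) (hy : y ≤ 1) :
    ∃ s ∈ Set.Ioo x y, f y - f x = unitDeriv f s * (y - x) := by
  obtain ⟨s, hs, h⟩ := exists_hasDerivAt_eq_slope f (unitDeriv f) hxy
    (hf.continuousOn.mono (Set.Icc_subset_Icc hx hy))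
    (fun s hs => hasDerivAt_unitDeriv hf ⟨hx.trans_lt hs.1, hs.2.trans_le hy⟩)
  refine ⟨s, hs, ?_⟩
  rw [h, div_mul_cancel₀ _ (by linarith)]

variable {h : ℝ → ℝ}

lemma contDiffOn_unitDeriv (hC2 : ContDiffOn ℝ 2 h (Set.Icc 0 1)) :
    ContDiffOn ℝ 1 (unitDeriv h) (Set.Icc 0 1) :=
  hC2.derivWithin uniqueDiffOn_unit (by norm_num)

/-- The slope of a uniformly concave `C²` function is bi-Lipschitz and decreasing. -/
lemma exists_unitDeriv_bounds (hC2 : ContDiffOn ℝ 2 h (Set.Icc 0 1))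
    (hneg : ∀ s ∈ Set.Icc (0 : ℝ) 1, unitDeriv (unitDeriv h) s < 0) :
    ∃ m L : ℝ, 0 < m ∧ 0 < L ∧ ∀ s s' : ℝ, 0 ≤ s → s ≤ s' → s' ≤ 1 →
      m * (s' - s) ≤ unitDeriv h s - unitDeriv h s' ∧
      unitDeriv h s - unitDeriv h s' ≤ L * (s' - s) := by
  have hd := contDiffOn_unitDeriv hC2
  have hc : ContinuousOn (unitDeriv (unitDeriv h)) (Set.Icc 0 1) :=
    hd.continuousOn_derivWithin uniqueDiffOn_unit le_rfl
  have hne : (Set.Icc (0 : ℝ) 1).Nonempty := ⟨0, by simp⟩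
  obtain ⟨x, hx, hmin⟩ := isCompact_Icc.exists_isMinOn hne hc
  obtain ⟨y, hy, hmax⟩ := isCompact_Icc.exists_isMaxOn hne hc
  refine ⟨-unitDeriv (unitDeriv h) y, -unitDeriv (unitDeriv h) x, by linarith [hneg y hy],
    by linarith [hneg x hx], fun s s' h0 hss h1 => ?_⟩
  rcases hss.eq_or_lt with rfl | hss
  · simp
  obtain ⟨c, hc, e⟩ := exists_unitDeriv_eq_slope (hd.differentiableOn (by norm_num)) h0 hss h1
  have hcI : c ∈ Set.Icc (0 : ℝ) 1 := ⟨h0.trans hc.1.le, hc.2.le.trans h1⟩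
  have h2 : unitDeriv (unitDeriv h) x ≤ unitDeriv (unitDeriv h) c := hmin hcI
  have h3 : unitDeriv (unitDeriv h) c ≤ unitDeriv (unitDeriv h) y := hmax hcI
  constructor <;> nlinarith

lemma exists_obstacle_sub_eq (hd : DifferentiableOn ℝ h (Set.Icc 0 1)) {n i j : ℕ} (hij : i < j)
    (hj : j ≤ n) : ∃ s : ℝ, (i : ℝ) / n ≤ s ∧ s ≤ (j : ℝ) / n ∧
      obstacle h n j - obstacle h n i = ((j : ℝ) - i) * unitDeriv h s := by
  have hn : (0 : ℝ) < n := by exact_mod_cast (by omega : 0 < n)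
  have hij' : (i : ℝ) / n < (j : ℝ) / n := by
    have : (i : ℝ) < j := by exact_mod_cast hij
    gcongr
  have hj' : (j : ℝ) / n ≤ 1 := by
    rw [div_le_one hn]; exact_mod_cast hj
  obtain ⟨s, hs, e⟩ := exists_unitDeriv_eq_slope hd (by positivity) hij' hj'
  refine ⟨s, hs.1.le, hs.2.le, ?_⟩
  unfold obstacle
  rw [← mul_sub, e]
  field_simp

/-- The increment of the obstacle at step `k`. -/
def slope (h : ℝ → ℝ) (n k : ℕ) : ℝ := obstacle h n (k + 1) - obstacle h n k

/-- Second differences of the obstacle are of order `1/n`. -/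
lemma slope_sub_slope_bounds (hd : DifferentiableOn ℝ h (Set.Icc 0 1)) {m L : ℝ}
    (hb : ∀ s s' : ℝ, 0 ≤ s → s ≤ s' → s' ≤ 1 →
      m * (s' - s) ≤ unitDeriv h s - unitDeriv h s' ∧
      unitDeriv h s - unitDeriv h s' ≤ L * (s' - s)) {n k : ℕ} (hk : k + 2 ≤ n) :
    m / n ≤ slope h n k - slope h n (k + 1) ∧ slope h n k - slope h n (k + 1) ≤ L / n := by
  have hn : (0 : ℝ) < n := by exact_mod_cast (by omega : 0 < n)
  have hk' : (k : ℝ) + 2 ≤ n := by exact_mod_cast hk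
  set x : ℝ := k / n with hx
  set η : ℝ := 1 / n with hη
  have hη0 : 0 < η := by positivity
  have hx0 : 0 ≤ x := by positivity
  have hx2 : x + 2 * η ≤ 1 := by
    rw [hx, hη, show (k : ℝ) / n + 2 * (1 / n) = (k + 2) / n by ring, div_le_one hn]
    exact hk'
  have e1 : ((k + 1 : ℕ) : ℝ) / n = x + η := by push_cast; rw [hx, hη]; ring
  have e2 : ((k + 1 + 1 : ℕ) : ℝ) / n = x + η + η := by push_cast; rw [hx, hη]; ring
  -- One application of the mean value theorem to `s ↦ h(s) - h(s + η)` turns the second difference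
  -- into a difference of `h'` at distance `η = 1/n`.
  obtain ⟨c, hc, e⟩ := exists_hasDerivAt_eq_slope (fun s => h s - h (s + η))
    (fun s => unitDeriv h s - unitDeriv h (s + η)) (show x < x + η by linarith)
    ((hd.continuousOn.mono (Set.Icc_subset_Icc hx0 (by linarith))).sub
      (hd.continuousOn.comp (by fun_prop) (fun s hs => by
        constructor <;> linarith [hs.1, hs.2])))
    (fun s hs => by
      have h1 := hasDerivAt_unitDeriv hd (x := s) ⟨by linarith [hs.1], by linarith [hs.2]⟩
      have h2 := hasDerivAt_unitDeriv hd (x := s + η) ⟨by linarith [hs.1], by linarith [hs.2]⟩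
      exact h1.sub (h2.comp_add_const s η))
  have hval : slope h n k - slope h n (k + 1) = unitDeriv h c - unitDeriv h (c + η) := by
    rw [e]
    unfold slope obstacle
    rw [e1, e2, ← hx, show x + η - x = η by ring, hη, div_div_eq_mul_div]
    simp only [← hη]
    ring
  rw [hval]
  have := hb c (c + η) (by linarith [hc.1]) (by linarith) (by linarith [hc.2])
  rw [show c + η - c = 1 / n by rw [hη]; ring, mul_one_div, mul_one_div] at this
  exact this

/-- Riemann sums of a Lipschitz function, scaled by the number of nodes, have bounded error. -/
lemma abs_riemann_sum_sub_le {J : ℝ → ℝ} {B : ℝ} (hB : 0 ≤ B)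
    (hJ : ∀ s ∈ Set.Icc (0 : ℝ) 1, ∀ s' ∈ Set.Icc (0 : ℝ) 1, |J s - J s'| ≤ B * |s - s'|) {n : ℕ}
    (hn : 1 ≤ n) {p : ℕ → ℝ}
    (hp : ∀ k < n, (k : ℝ) / n ≤ p k ∧ p k ≤ ((k + 1 : ℕ) : ℝ) / n) :
    |∑ k ∈ Finset.range n, J (p k) - n * ∫ s in (0 : ℝ)..1, J s| ≤ B := by
  have hn0 : (0 : ℝ) < n := by exact_mod_cast hn
  have hcont : ContinuousOn J (Set.Icc 0 1) := by
    have : LipschitzOnWith B.toNNReal J (Set.Icc 0 1) := by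
      refine LipschitzOnWith.of_dist_le_mul fun s hs s' hs' => ?_
      rw [Real.dist_eq, Real.dist_eq, Real.coe_toNNReal _ hB]
      exact hJ s hs s' hs'
    exact this.continuousOn
  have hsub : ∀ k < n, Set.Icc ((k : ℝ) / n) (((k + 1 : ℕ) : ℝ) / n) ⊆ Set.Icc 0 1 := by
    intro k hk
    refine Set.Icc_subset_Icc (by positivity) ?_
    rw [div_le_one hn0]
    exact_mod_cast hk
  have hle : ∀ k : ℕ, (k : ℝ) / n ≤ ((k + 1 : ℕ) : ℝ) / n := fun k => by
    push_cast; gcongr; linarith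
  have hint : ∀ k < n, IntervalIntegrable J volume ((k : ℝ) / n) (((k + 1 : ℕ) : ℝ) / n) := by
    intro k hk
    refine ContinuousOn.intervalIntegrable ?_
    rw [Set.uIcc_of_le (hle k)]
    exact hcont.mono (hsub k hk)
  have hsum := intervalIntegral.sum_integral_adjacent_intervals (μ := volume)
    (f := J) (a := fun k : ℕ => (k : ℝ) / n) (n := n) hint
  simp only [Nat.cast_zero, zero_div, div_self hn0.ne'] at hsum
  rw [← hsum, Finset.mul_sum, ← Finset.sum_sub_distrib]
  refine (Finset.abs_sum_le_sum_abs _ _).trans ?_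
  calc ∑ k ∈ Finset.range n, |J (p k) - n * ∫ s in ((k : ℝ) / n)..(((k + 1 : ℕ) : ℝ) / n), J s|
      ≤ ∑ k ∈ Finset.range n, B / n := by
        refine Finset.sum_le_sum fun k hk => ?_
        have hk' := Finset.mem_range.1 hk
        have hwid : ((k + 1 : ℕ) : ℝ) / n - (k : ℝ) / n = 1 / n := by push_cast; ring
        have hpI := hsub k hk' ⟨(hp k hk').1, (hp k hk').2⟩
        -- On a cell of width `1/n` the integrand is at most `B/n`, so the scaled error per cell is
        -- `B/n`, and there are `n` cells.
        have h1 : J (p k) - n * ∫ s in ((k : ℝ) / n)..(((k + 1 : ℕ) : ℝ) / n), J s =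
            n * ∫ s in ((k : ℝ) / n)..(((k + 1 : ℕ) : ℝ) / n), (J (p k) - J s) := by
          rw [intervalIntegral.integral_sub (by simp) (hint k hk'),
            intervalIntegral.integral_const, hwid, smul_eq_mul]
          field_simp
        have h2 := intervalIntegral.norm_integral_le_of_norm_le_const
          (a := (k : ℝ) / n) (b := ((k + 1 : ℕ) : ℝ) / n) (f := fun s => J (p k) - J s)
          (C := B / n) (fun s hs => by
            rw [Set.uIoc_of_le (hle k)] at hs
            have hsI := hsub k hk' ⟨hs.1.le, hs.2⟩
            refine (hJ _ hpI _ hsI).trans ?_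
            rw [div_eq_mul_one_div]
            refine mul_le_mul_of_nonneg_left ?_ hB
            rw [abs_le]
            constructor <;> linarith [(hp k hk').1, (hp k hk').2, hs.1, hs.2])
        rw [h1, abs_mul, abs_of_pos hn0]
        rw [Real.norm_eq_abs, hwid, abs_of_pos (by positivity : (0 : ℝ) < 1 / n)] at h2
        calc (n : ℝ) * |∫ s in ((k : ℝ) / n)..(((k + 1 : ℕ) : ℝ) / n), (J (p k) - J s)|
            ≤ n * (B / n * (1 / n)) := mul_le_mul_of_nonneg_left h2 hn0.le
          _ = B / n := by field_simp
    _ = B := by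
        rw [Finset.sum_const, Finset.card_range, nsmul_eq_mul]
        field_simp

end Obstacle

/-! ### Super- and subsolutions of the killed kernel -/

section Comparison

variable {Ω : Type*} [MeasurableSpace Ω] {P : Measure Ω} {ξ : Ω → ℤ}

/-- The one-step kernel applied to an exponentially weighted profile, through the tilted measure. -/
lemma stepOp_exp_mul [IsProbabilityMeasure P] (hξ : Measurable ξ) {t : ℝ}
    (ht : t ∈ integrableExpSet (fun ω => (ξ ω : ℝ)) P) {G : ℝ → ℝ} (hGm : Measurable G)
    (hG0 : ∀ x, 0 ≤ G x) (hG2 : ∀ x, G x ≤ 2) (hGneg : ∀ x < 0, G x = 0) {ε : ℝ} (hε : 0 < ε)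
    {A : ℝ} (hA : 0 ≤ A) (c c' : ℝ) (z : ℤ) :
    stepOp P ξ c' (fun w => ENNReal.ofReal (A * Real.exp (t * (w - c')) * G (ε * (w - c')))) z =
      ENNReal.ofReal (A * Real.exp (t * (z - c) - (t * (c' - c) - cgf (fun ω => (ξ ω : ℝ)) P t)) *
        ∫ ω, G (ε * (z - c) + ε * (ξ ω - (c' - c))) ∂(P.tilted (fun ω => t * (ξ ω : ℝ)))) := by
  have : IsProbabilityMeasure (P.tilted (fun ω => t * (ξ ω : ℝ))) := isProbabilityMeasure_tilted ht
  set Y : Ω → ℝ := fun ω => (ξ ω : ℝ) with hY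
  set B := A * Real.exp (t * (z - c) - (t * (c' - c) - cgf Y P t)) with hB
  have hB0 : 0 ≤ B := mul_nonneg hA (Real.exp_pos _).le
  have hYm : Measurable Y := (measurable_ofInt _).comp hξ
  have hFm : Measurable fun ω => G (ε * (z - c) + ε * (Y ω - (c' - c))) :=
    hGm.comp (by fun_prop)
  have hint : Integrable (fun ω => G (ε * (z - c) + ε * (Y ω - (c' - c))))
      (P.tilted (fun ω => t * Y ω)) := by
    refine Integrable.of_bound (C := 2) hFm.aestronglyMeasurable
      (Filter.Eventually.of_forall fun ω => ?_)
    rw [Real.norm_eq_abs, abs_of_nonneg (hG0 _)]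
    exact hG2 _
  -- Killing is automatic because `G` vanishes on the negatives. The exponent at arrival splits as
  -- `t(z - c) - (t(c' - c) - H(t))` plus `tξ - H(t)`, and the last part is the logarithm of the
  -- tilting density.
  have hpt : ∀ ω, (if c' ≤ ((z + ξ ω : ℤ) : ℝ) then ENNReal.ofReal (A *
      Real.exp (t * (((z + ξ ω : ℤ) : ℝ) - c')) * G (ε * (((z + ξ ω : ℤ) : ℝ) - c'))) else 0) =
      ENNReal.ofReal (Real.exp (t * Y ω - cgf Y P t)) *
        (ENNReal.ofReal B * ENNReal.ofReal (G (ε * (z - c) + ε * (Y ω - (c' - c))))) := by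
    intro ω
    have e1 : ε * (z - c) + ε * (Y ω - (c' - c)) = ε * (((z + ξ ω : ℤ) : ℝ) - c') := by
      rw [hY]; push_cast; ring
    rw [e1]
    split_ifs with hc
    · rw [← ENNReal.ofReal_mul hB0, ← ENNReal.ofReal_mul (Real.exp_pos _).le]
      congr 1
      rw [hB, ← mul_assoc, mul_left_comm, ← Real.exp_add]
      congr 3
      rw [hY]
      push_cast
      ring
    · rw [hGneg _ (mul_neg_of_pos_of_neg hε (by linarith))]
      simp
  unfold stepOp
  simp_rw [hpt]
  rw [ENNReal.ofReal_mul hB0, ofReal_integral_eq_lintegral_ofReal hint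
    (Filter.Eventually.of_forall fun ω => hG0 _), lintegral_tilted]
  rw [← lintegral_const_mul _ (by fun_prop)]
  refine lintegral_congr fun ω => ?_
  rw [Real.exp_sub, exp_cgf ht, mgf]
  ring

/-- Upper bound for the killed kernel: staying above the obstacle costs `exp (-l n^{1/3})` on top
of the sum of the rates. -/
lemma backOp_target_le [IsProbabilityMeasure P] (hξ : Measurable ξ) {n : ℕ} (hn : 1 ≤ n) {r : ℝ}
    (hr : 0 < r) (hrn : r ^ 3 = n) {c τ : ℕ → ℝ} (hc0 : c 0 = 0)
    (hτ : ∀ k < n, τ (k + 1) ∈ integrableExpSet (fun ω => (ξ ω : ℝ)) P) {c₁ l A : ℝ}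
    (hdiff : ∀ k < n, c₁ / n ≤ τ k - τ (k + 1)) (hA : |τ n| ≤ A)
    (hstep : ∀ k < n, ∀ x : ℝ, 0 ≤ x → Real.exp (-c₁ * r⁻¹ ^ 2 * x) *
      ∫ ω, satProfile (x + r⁻¹ * (ξ ω - (c (k + 1) - c k)))
        ∂(P.tilted (fun ω => τ (k + 1) * (ξ ω : ℝ))) ≤
      Real.exp (-l * r⁻¹ ^ 2) * satProfile x) :
    backOp P ξ c 0 n (Set.indicator {⌈c n⌉} 1) 0 ≤
      ENNReal.ofReal (Real.exp (A - (∑ k ∈ Finset.range n, (τ (k + 1) * (c (k + 1) - c k) -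
        cgf (fun ω => (ξ ω : ℝ)) P (τ (k + 1)))) - l * r)) := by
  set I : ℕ → ℝ := fun k => τ (k + 1) * (c (k + 1) - c k) -
    cgf (fun ω => (ξ ω : ℝ)) P (τ (k + 1)) with hI
  set ε := r⁻¹ with hε
  have hε0 : 0 < ε := inv_pos.2 hr
  have hn0 : (0 : ℝ) < n := by exact_mod_cast hn
  have hεn : (1 : ℝ) / n = ε ^ 3 := by rw [← hrn, hε, inv_pow, one_div]
  set E : ℕ → ℝ := fun k => Real.exp (-(∑ i ∈ Finset.Ico k n, I i) - l * ε ^ 2 * (n - k)) with hE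
  set g : ℕ → ℤ → ℝ≥0∞ := fun k z =>
    ENNReal.ofReal (E k * Real.exp (τ k * (z - c k)) * satProfile (ε * (z - c k))) with hg
  have hsuper : ∀ k < n, ∀ z : ℤ, c k ≤ z → stepOp P ξ (c (k + 1)) (g (k + 1)) z ≤ g k z := by
    intro k hk z hz
    have hx : 0 ≤ ε * (z - c k) := mul_nonneg hε0.le (by linarith)
    rw [hg]
    simp only
    rw [stepOp_exp_mul hξ (hτ k hk) measurable_satProfile satProfile_nonneg satProfile_le_two
      (fun x hx => if_neg (not_le.2 hx)) hε0 (Real.exp_pos _).le (c k)]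
    refine ENNReal.ofReal_le_ofReal ?_
    have hs := hstep k hk _ hx
    set S := ∫ ω, satProfile (ε * (z - c k) + ε * (ξ ω - (c (k + 1) - c k)))
        ∂(P.tilted (fun ω => τ (k + 1) * (ξ ω : ℝ))) with hS
    have hS0 : 0 ≤ S := integral_nonneg fun ω => satProfile_nonneg _
    have hEk : E k = E (k + 1) * Real.exp (-I k) * Real.exp (-l * ε ^ 2) := by
      rw [hE]
      simp only
      rw [← Real.exp_add, ← Real.exp_add, Finset.sum_eq_sum_Ico_succ_bot hk]
      push_cast
      ring_nf
    -- The weight at time `k` carries `τ k` but the step is tilted by `τ (k + 1)`. The mismatch, of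
    -- order height`/n`, is the linear potential `c₁ε²x`.
    have hy : Real.exp (τ (k + 1) * (z - c k)) ≤
        Real.exp (τ k * (z - c k)) * Real.exp (-c₁ * ε ^ 2 * (ε * (z - c k))) := by
      rw [← Real.exp_add]
      refine Real.exp_le_exp.2 ?_
      have h1 := mul_le_mul_of_nonneg_right (hdiff k hk) (sub_nonneg.2 hz)
      have h2 : c₁ / n = c₁ * ε ^ 3 := by rw [← hεn]; ring
      rw [h2] at h1
      nlinarith
    have e1 : Real.exp (τ (k + 1) * (z - c k) - (τ (k + 1) * (c (k + 1) - c k) -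
        cgf (fun ω => (ξ ω : ℝ)) P (τ (k + 1)))) =
        Real.exp (τ (k + 1) * (z - c k)) * Real.exp (-I k) := by
      rw [← Real.exp_add, hI]; ring_nf
    rw [e1, hEk]
    have hEp : 0 < E (k + 1) := Real.exp_pos _
    have hIp := Real.exp_pos (-I k)
    have hTp := Real.exp_pos (τ k * (z - c k))
    calc E (k + 1) * (Real.exp (τ (k + 1) * (z - c k)) * Real.exp (-I k)) * S
        = E (k + 1) * Real.exp (-I k) * (Real.exp (τ (k + 1) * (z - c k)) * S) := by ring
      _ ≤ E (k + 1) * Real.exp (-I k) * (Real.exp (τ k * (z - c k)) *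
            Real.exp (-c₁ * ε ^ 2 * (ε * (z - c k))) * S) := by
          refine mul_le_mul_of_nonneg_left ?_ (by positivity)
          exact mul_le_mul_of_nonneg_right hy hS0
      _ = E (k + 1) * Real.exp (-I k) * Real.exp (τ k * (z - c k)) *
            (Real.exp (-c₁ * ε ^ 2 * (ε * (z - c k))) * S) := by ring
      _ ≤ E (k + 1) * Real.exp (-I k) * Real.exp (τ k * (z - c k)) *
            (Real.exp (-l * ε ^ 2) * satProfile (ε * (z - c k))) :=
          mul_le_mul_of_nonneg_left hs (by positivity)
      _ = _ := by ring
  have hmain := backOp_le_of_supersolution hsuper n 0 (zero_add n) 0 (by simp [hc0])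
  -- The target overshoots the obstacle by at most `1`, so the weight there is at least `e^{-A}`,
  -- while the profile is at least `1`.
  have hterm : ∀ z : ℤ, Set.indicator {⌈c n⌉} (1 : ℤ → ℝ≥0∞) z ≤
      ENNReal.ofReal (Real.exp A) * g n z := by
    intro z
    by_cases hz : z = ⌈c n⌉
    · subst hz
      rw [Set.indicator_of_mem (Set.mem_singleton _), hg]
      simp only
      rw [← ENNReal.ofReal_mul (Real.exp_pos _).le]
      have hy0 : 0 ≤ (⌈c n⌉ : ℝ) - c n := by linarith [Int.le_ceil (c n)]
      have hy1 : (⌈c n⌉ : ℝ) - c n ≤ 1 := by linarith [Int.ceil_lt_add_one (c n)]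
      have hEn : E n = 1 := by simp [hE]
      rw [hEn, one_mul, ← mul_assoc, ← Real.exp_add, Pi.one_apply, ENNReal.one_le_ofReal]
      have h1 : 1 ≤ Real.exp (A + τ n * (⌈c n⌉ - c n)) := by
        rw [Real.one_le_exp_iff]
        have h2 : |τ n * (⌈c n⌉ - c n)| ≤ A * 1 := by
          rw [abs_mul, abs_of_nonneg hy0]
          exact mul_le_mul hA hy1 hy0 ((abs_nonneg _).trans hA)
        linarith [neg_abs_le (τ n * (⌈c n⌉ - c n))]
      have h3 := one_le_satProfile (mul_nonneg hε0.le hy0)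
      nlinarith
    · rw [Set.indicator_of_notMem (by simpa using hz)]
      exact zero_le
  calc backOp P ξ c 0 n (Set.indicator {⌈c n⌉} 1) 0
      ≤ backOp P ξ c 0 n (fun z => ENNReal.ofReal (Real.exp A) * g n z) 0 := backOp_mono hterm _ _ _
    _ = ENNReal.ofReal (Real.exp A) * backOp P ξ c 0 n (g n) 0 := by rw [backOp_const_mul hξ]
    _ ≤ ENNReal.ofReal (Real.exp A) * g 0 0 := mul_le_mul_right hmain _
    _ = _ := by
        rw [hg]
        simp only
        rw [← ENNReal.ofReal_mul (Real.exp_pos _).le]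
        congr 1
        have h4 : satProfile 0 = 1 := by rw [satProfile_of_nonneg le_rfl]; norm_num
        have h5 : ε ^ 2 * n = r := by
          rw [← hrn, hε]; field_simp
        simp only [hc0, Int.cast_zero, sub_zero, mul_zero, Real.exp_zero, h4, mul_one, hE,
          Nat.cast_zero, ← Finset.range_eq_Ico]
        rw [← Real.exp_add]
        congr 1
        rw [mul_assoc l, h5]
        ring

/-- Lower bound for the killed kernel between two times: staying in a tube of width `2r` around
height `R r` costs `exp (-l' r⁻² (m - k₀))` on top of the sum of the rates. -/
lemma bump_le_backOp [IsProbabilityMeasure P] (hξ : Measurable ξ) {n k₀ m : ℕ} (hkm : k₀ ≤ m)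
    (hmn : m ≤ n) {r : ℝ} (hr : 0 < r) (hrn : r ^ 3 = n) {c τ : ℕ → ℝ}
    (hτ : ∀ k < n, τ (k + 1) ∈ integrableExpSet (fun ω => (ξ ω : ℝ)) P) {c₂ l R : ℝ} (hR : 1 ≤ R)
    (hdiff0 : ∀ k < n, 0 ≤ τ k - τ (k + 1)) (hdiff : ∀ k < n, τ k - τ (k + 1) ≤ c₂ / n)
    (hstep : ∀ k < n, ∀ w : ℝ, Real.exp (-l * r⁻¹ ^ 2) * bump w ≤
      ∫ ω, bump (w + r⁻¹ * (ξ ω - (c (k + 1) - c k)))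
        ∂(P.tilted (fun ω => τ (k + 1) * (ξ ω : ℝ)))) (z : ℤ) :
    ENNReal.ofReal (Real.exp (-(∑ k ∈ Finset.Ico k₀ m, (τ (k + 1) * (c (k + 1) - c k) -
        cgf (fun ω => (ξ ω : ℝ)) P (τ (k + 1)))) - (l + c₂ * (R + 1)) * r⁻¹ ^ 2 * (m - k₀)) *
        Real.exp (τ k₀ * (z - c k₀)) * bump (r⁻¹ * (z - c k₀) - R)) ≤
      backOp P ξ c k₀ (m - k₀) (fun w => ENNReal.ofReal (Real.exp (τ m * (w - c m)) *
        bump (r⁻¹ * (w - c m) - R))) z := by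
  set I : ℕ → ℝ := fun k => τ (k + 1) * (c (k + 1) - c k) -
    cgf (fun ω => (ξ ω : ℝ)) P (τ (k + 1)) with hI
  set ε := r⁻¹ with hε
  have hε0 : 0 < ε := inv_pos.2 hr
  have hεn : (1 : ℝ) / n = ε ^ 3 := by rw [← hrn, hε, inv_pow, one_div]
  -- On the support of the bump the rescaled height is at most `R + 1`, so the potential costs at
  -- most `c₂(R + 1)ε²` per step.
  set l' := l + c₂ * (R + 1) with hl'
  set E : ℕ → ℝ := fun k => Real.exp (-(∑ i ∈ Finset.Ico k m, I i) - l' * ε ^ 2 * (m - k)) with hE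
  set G : ℝ → ℝ := fun x => bump (x - R) with hG
  set g : ℕ → ℤ → ℝ≥0∞ := fun k z =>
    ENNReal.ofReal (E k * Real.exp (τ k * (z - c k)) * G (ε * (z - c k))) with hg
  -- As `R ≥ 1`, the shifted bump never sees the killing level.
  have hGneg : ∀ x < 0, G x = 0 := fun x hx => if_neg (fun h => by
    have := (abs_le.1 h).1
    linarith)
  have hsub : ∀ k < m, k₀ ≤ k → ∀ z : ℤ, g k z ≤ stepOp P ξ (c (k + 1)) (g (k + 1)) z := by
    intro k hk _ z
    have hkn : k < n := hk.trans_le hmn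
    rw [hg]
    simp only
    rw [stepOp_exp_mul (G := G) hξ (hτ k hkn) (measurable_bump.comp (by fun_prop)) (fun x => bump_nonneg _)
      (fun x => (bump_le_one _).trans (by norm_num)) hGneg hε0 (Real.exp_pos _).le (c k)]
    refine ENNReal.ofReal_le_ofReal ?_
    have hs := hstep k hkn (ε * (z - c k) - R)
    have hS' : ∫ ω, G (ε * (z - c k) + ε * (ξ ω - (c (k + 1) - c k)))
        ∂(P.tilted (fun ω => τ (k + 1) * (ξ ω : ℝ))) =
        ∫ ω, bump (ε * (z - c k) - R + ε * (ξ ω - (c (k + 1) - c k)))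
        ∂(P.tilted (fun ω => τ (k + 1) * (ξ ω : ℝ))) := by
      refine integral_congr_ae (Filter.Eventually.of_forall fun ω => ?_)
      simp only [hG]
      ring_nf
    rw [hS']
    set S := ∫ ω, bump (ε * (z - c k) - R + ε * (ξ ω - (c (k + 1) - c k)))
        ∂(P.tilted (fun ω => τ (k + 1) * (ξ ω : ℝ))) with hS
    have hEk : E k = E (k + 1) * Real.exp (-I k) * Real.exp (-l' * ε ^ 2) := by
      rw [hE]
      simp only
      rw [← Real.exp_add, ← Real.exp_add, Finset.sum_eq_sum_Ico_succ_bot hk]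
      push_cast
      ring_nf
    have e1 : Real.exp (τ (k + 1) * (z - c k) - (τ (k + 1) * (c (k + 1) - c k) -
        cgf (fun ω => (ξ ω : ℝ)) P (τ (k + 1)))) =
        Real.exp (τ (k + 1) * (z - c k)) * Real.exp (-I k) := by
      rw [← Real.exp_add, hI]; ring_nf
    rw [e1, hEk]
    have hEp : 0 < E (k + 1) := Real.exp_pos _
    have hIp := Real.exp_pos (-I k)
    have hTp := Real.exp_pos (τ (k + 1) * (z - c k))
    have hkey : Real.exp (-l' * ε ^ 2) * Real.exp (τ k * (z - c k)) * G (ε * (z - c k)) ≤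
        Real.exp (τ (k + 1) * (z - c k)) * S := by
      by_cases hb : G (ε * (z - c k)) = 0
      · rw [hb, mul_zero]
        exact mul_nonneg hTp.le (integral_nonneg fun ω => bump_nonneg _)
      have hb1 := abs_le.1 (abs_le_one_of_bump_ne_zero hb)
      have hy0 : 0 ≤ ε * (z - c k) := by linarith
      have hyz : 0 ≤ (z - c k : ℝ) := nonneg_of_mul_nonneg_right hy0 hε0
      have h1 : Real.exp (-l' * ε ^ 2) * Real.exp (τ k * (z - c k)) ≤
          Real.exp (τ (k + 1) * (z - c k)) * Real.exp (-l * ε ^ 2) := by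
        rw [← Real.exp_add, ← Real.exp_add]
        refine Real.exp_le_exp.2 ?_
        have h2 := mul_le_mul_of_nonneg_right (hdiff k hkn) hyz
        have h3 : c₂ / n = c₂ * ε ^ 3 := by rw [← hεn]; ring
        rw [h3] at h2
        have h4 : 0 ≤ c₂ * ε ^ 3 := h3 ▸ (hdiff0 k hkn).trans (hdiff k hkn)
        have h5 : 0 ≤ c₂ * ε ^ 2 := nonneg_of_mul_nonneg_left (by nlinarith : 0 ≤ c₂ * ε ^ 2 * ε) hε0
        have h6 : c₂ * ε ^ 2 * (ε * (z - c k)) ≤ c₂ * ε ^ 2 * (R + 1) :=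
          mul_le_mul_of_nonneg_left (by linarith) h5
        rw [hl']
        nlinarith
      calc Real.exp (-l' * ε ^ 2) * Real.exp (τ k * (z - c k)) * G (ε * (z - c k))
          ≤ Real.exp (τ (k + 1) * (z - c k)) * Real.exp (-l * ε ^ 2) * G (ε * (z - c k)) :=
            mul_le_mul_of_nonneg_right h1 (bump_nonneg _)
        _ = Real.exp (τ (k + 1) * (z - c k)) * (Real.exp (-l * ε ^ 2) * bump (ε * (z - c k) - R)) := by
            rw [hG]; ring
        _ ≤ _ := mul_le_mul_of_nonneg_left hs hTp.le
    calc E (k + 1) * Real.exp (-I k) * Real.exp (-l' * ε ^ 2) * Real.exp (τ k * (z - c k)) *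
          G (ε * (z - c k))
        = E (k + 1) * Real.exp (-I k) * (Real.exp (-l' * ε ^ 2) * Real.exp (τ k * (z - c k)) *
          G (ε * (z - c k))) := by ring
      _ ≤ E (k + 1) * Real.exp (-I k) * (Real.exp (τ (k + 1) * (z - c k)) * S) :=
          mul_le_mul_of_nonneg_left hkey (by positivity)
      _ = _ := by ring
  have hmain := le_backOp_of_subsolution hsub (m - k₀) k₀ le_rfl (by omega) z
  have hgm : g m = fun w : ℤ => ENNReal.ofReal (Real.exp (τ m * (w - c m)) *
        bump (ε * (w - c m) - R)) := by
    funext w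
    simp [hg, hE, hG]
  rw [hgm] at hmain
  exact hmain

end Comparison

/-! ### Joining the tube to both ends -/

section LowerBound

variable {Ω : Type*} [MeasurableSpace Ω] {P : Measure Ω} {ξ : Ω → ℤ}

/-- Hitting the target exactly: blocks of bounded steps far above the obstacle followed by constant
steps flatter than the obstacle. -/
lemma le_backOp_target (hξ : Measurable ξ) {K : ℕ} {C : ℝ} {q : ℝ≥0∞} {c : ℕ → ℝ} {n m G N : ℕ}
    (hblock : ∀ D : ℤ, |D| ≤ G → ∃ L : List ℤ, L.length = G * K ∧ L.sum = D ∧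
        ∀ x ∈ L, q ≤ P {ω | ξ ω = x} ∧ -C ≤ (x : ℝ))
    {j : ℤ} (hj : q ≤ P {ω | ξ ω = j}) (hn : m + (G * K + N) = n) {z : ℤ}
    (hD : |⌈c n⌉ - N * j - z| ≤ (G : ℤ))
    (hfar : ∀ i ≤ G * K, c (m + i) ≤ z - i * C)
    (hflat : ∀ k ≤ n, ((n : ℝ) - k) * j ≤ c n - c k) :
    q ^ (G * K + N) ≤ backOp P ξ c m (G * K + N) (Set.indicator {⌈c n⌉} 1) z := by
  obtain ⟨L, hLl, hLs, hL⟩ := hblock _ hD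
  rw [backOp_add, pow_add]
  have h1 := le_backOp_list (P := P) (c := c)
    (φ := backOp P ξ c (m + G * K) N (Set.indicator {⌈c n⌉} 1)) hξ L hL m z
    (fun i hi _ => hfar i (hLl ▸ hi))
  rw [hLl, hLs] at h1
  refine le_trans ?_ h1
  refine mul_le_mul_right ?_ _
  -- Read backwards from the target, a path of slope `j` stays above the obstacle, by `hflat`.
  have h2 := le_backOp_const_steps (P := P) (c := c) (φ := Set.indicator {⌈c n⌉} 1) hξ hj N
    (m + G * K) (z + (⌈c n⌉ - N * j - z)) (fun i hi _ => by
      have e := hflat (m + G * K + i) (by omega)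
      have e1 : (n : ℝ) = m + (G * K + N) := by rw [← hn]; push_cast; ring
      have e2 := Int.le_ceil (c n)
      push_cast at e ⊢
      rw [e1] at e
      nlinarith)
  rwa [show z + (⌈c n⌉ - N * j - z) + N * j = ⌈c n⌉ by ring,
    Set.indicator_of_mem (Set.mem_singleton _), Pi.one_apply, mul_one] at h2

/-- Lengths of the initial and of the two final phases of the lower bound strategy. -/
lemma exists_phase_lengths {dp dm L C d₀ d₁ : ℝ} (hdp : 0 < dp) (hdm : 0 < dm) (hL : 0 < L)
    (hC : 0 ≤ C) (K : ℕ) :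
    ∃ R B r₀ : ℝ, 1 ≤ R ∧ 0 ≤ B ∧ 1 ≤ r₀ ∧ ∀ r : ℝ, r₀ ≤ r → ∃ N G N' : ℕ,
      (N : ℝ) + (G * K + N') ≤ B * r ∧ (N : ℝ) + (G * K + N') ≤ r ^ 3 ∧
      |N * dp - R * r| ≤ r / 4 ∧ L * (N : ℝ) ^ 2 ≤ r ^ 3 * (r / 4) ∧ r + dm + 2 ≤ G ∧
      R * r - dm ≤ G * K * d₁ + N' * dm ∧ G * K * d₁ + N' * dm ≤ R * r ∧
      L * ((G : ℝ) * K + N') ^ 2 ≤ r ^ 3 ∧ (G : ℝ) * K * (C + |d₀|) ≤ (R - 1) * r := by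
  -- The blocks take at most `2Kr` steps, each lowering the relative height by at most `C + |d₀|`.
  -- Starting from `(R - 1)r` therefore keeps them above the obstacle; the `|d₁|` term makes `N'`
  -- meaningful.
  set R : ℝ := 2 + 2 * K * (C + |d₀| + |d₁|) with hR
  have hR2 : 2 ≤ R := by
    have : 0 ≤ 2 * K * (C + |d₀| + |d₁|) := by positivity
    linarith
  set B : ℝ := R / dp + 2 * K + 2 * R / dm with hB
  have hB0 : 0 ≤ B := by positivity
  -- The summands of the threshold give in turn `G ≤ 2r`, a rounding error of at most `r/4` in the
  -- rise, a total duration below `r³`, and curvature errors of at most `r³/4`.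
  refine ⟨R, B, 1 + (dm + 3) + 4 * dp + B + 4 * L * B ^ 2, by linarith, hB0, ?_, fun r hr => ?_⟩
  · have : 0 ≤ 4 * L * B ^ 2 := by positivity
    linarith
  have hLB : 0 ≤ L * B ^ 2 := by positivity
  have hr1 : 1 ≤ r := by linarith
  have hr0 : 0 < r := by linarith
  set G := ⌈r + dm + 2⌉₊ with hG
  have hG1 : r + dm + 2 ≤ G := Nat.le_ceil _
  have hG2 : (G : ℝ) ≤ 2 * r := by
    have := Nat.ceil_lt_add_one (show 0 ≤ r + dm + 2 by linarith)
    linarith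
  have hK0 : (0 : ℝ) ≤ K := Nat.cast_nonneg K
  have hGK : (G : ℝ) * K ≤ 2 * K * r := by linarith [mul_le_mul_of_nonneg_right hG2 hK0]
  have hGK0 : (0 : ℝ) ≤ (G : ℝ) * K := by positivity
  have hGKd : |(G : ℝ) * K * d₁| ≤ 2 * K * |d₁| * r := by
    rw [abs_mul, abs_of_nonneg hGK0]
    linarith [mul_le_mul_of_nonneg_right hGK (abs_nonneg d₁)]
  have hGKR : |(G : ℝ) * K * d₁| ≤ R * r := by
    refine hGKd.trans (mul_le_mul_of_nonneg_right ?_ hr0.le)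
    have : 0 ≤ 2 * K * (C + |d₀|) := by positivity
    rw [hR]; linarith
  set N := ⌊R * r / dp⌋₊ with hN
  have hN1 : (N : ℝ) ≤ R * r / dp := Nat.floor_le (by positivity)
  have hN2 : R * r / dp < N + 1 := Nat.lt_floor_add_one _
  have hN1' : N * dp ≤ R * r := (le_div_iff₀ hdp).1 hN1
  have hN2' : R * r < (N + 1) * dp := (div_lt_iff₀ hdp).1 hN2
  -- The flat steps descend relative to the obstacle by `dm` each; they make up the height `Rr`,
  -- less the rise of the obstacle during the blocks.
  set N' := ⌊(R * r - G * K * d₁) / dm⌋₊ with hN'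
  have hnum : 0 ≤ R * r - G * K * d₁ := by linarith [(abs_le.1 hGKR).2]
  have hM1 : (N' : ℝ) ≤ (R * r - G * K * d₁) / dm := Nat.floor_le (by positivity)
  have hM2 : (R * r - G * K * d₁) / dm < N' + 1 := Nat.lt_floor_add_one _
  have hM1' : N' * dm ≤ R * r - G * K * d₁ := (le_div_iff₀ hdm).1 hM1
  have hM2' : R * r - G * K * d₁ < (N' + 1) * dm := (div_lt_iff₀ hdm).1 hM2
  have hM3 : (N' : ℝ) ≤ 2 * R / dm * r := by
    refine hM1.trans ?_
    rw [div_mul_eq_mul_div]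
    refine div_le_div_of_nonneg_right ?_ hdm.le
    linarith [(abs_le.1 hGKR).1]
  have hN3 : (N : ℝ) ≤ R / dp * r := by rw [div_mul_eq_mul_div]; exact hN1
  have htot : (N : ℝ) + (G * K + N') ≤ B * r := by
    have e : B * r = R / dp * r + 2 * K * r + 2 * R / dm * r := by rw [hB]; ring
    linarith
  have hN0 : (0 : ℝ) ≤ N := Nat.cast_nonneg _
  have hN'0 : (0 : ℝ) ≤ N' := Nat.cast_nonneg _
  have hsq : ∀ x : ℝ, 0 ≤ x → x ≤ B * r → L * x ^ 2 ≤ r ^ 3 / 4 := by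
    intro x hx hxB
    have h1 : x ^ 2 ≤ (B * r) ^ 2 := pow_le_pow_left₀ hx hxB 2
    have h2 : 4 * (L * B ^ 2) * r ^ 2 ≤ r * r ^ 2 :=
      mul_le_mul_of_nonneg_right (by linarith) (sq_nonneg r)
    have h3 : L * (B * r) ^ 2 = L * B ^ 2 * r ^ 2 := by ring
    have h4 : r * r ^ 2 = r ^ 3 := by ring
    linarith [mul_le_mul_of_nonneg_left h1 hL.le]
  have hr30 : 0 < r ^ 3 := by positivity
  refine ⟨N, G, N', htot, ?_, ?_, ?_, hG1, by linarith, by linarith, ?_, ?_⟩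
  · refine htot.trans ?_
    have : B * r ≤ r * r := mul_le_mul_of_nonneg_right (by linarith) hr0.le
    have h3 : r * r ≤ r * r * r := le_mul_of_one_le_right (mul_self_nonneg r) hr1
    have h4 : r ^ 3 = r * r * r := by ring
    linarith
  · rw [abs_le]; constructor <;> linarith
  · have := hsq N hN0 (by linarith)
    have h3 : r ^ 3 * 1 ≤ r ^ 3 * r := mul_le_mul_of_nonneg_left hr1 hr30.le
    linarith
  · have := hsq _ (by positivity) (by linarith : (G : ℝ) * K + N' ≤ B * r)
    linarith
  · have h1 : 0 ≤ C + |d₀| := by positivity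
    have h2 : 0 ≤ 2 * K * |d₁| := by positivity
    calc (G : ℝ) * K * (C + |d₀|) ≤ 2 * K * r * (C + |d₀|) := mul_le_mul_of_nonneg_right hGK h1
      _ ≤ (R - 1) * r := by
        have h3 := mul_nonneg h2 hr0.le
        have h4 : (R - 1) * r = 2 * K * r * (C + |d₀|) + 2 * K * |d₁| * r + r := by rw [hR]; ring
        linarith

/-- Every site of the tube reaches the target with a probability exponentially small in the number
of the final steps. -/
lemma weighted_bump_le_backOp_target (hξ : Measurable ξ) {K : ℕ} {C q : ℝ} (hq : 0 < q) (hC : 0 ≤ C)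
    {G N m n : ℕ} (hblock : ∀ D : ℤ, |D| ≤ G → ∃ L : List ℤ, L.length = G * K ∧ L.sum = D ∧
        ∀ x ∈ L, ENNReal.ofReal q ≤ P {ω | ξ ω = x} ∧ -C ≤ (x : ℝ))
    {j : ℤ} (hj : ENNReal.ofReal q ≤ P {ω | ξ ω = j}) {r R A d₀ d₁ L t : ℝ} (hr : 0 < r)
    (hR : 1 ≤ R) (hA : 0 ≤ A) (hd₁ : j < d₁) {c : ℕ → ℝ} (hm : m + (G * K + N) = n) (ht : |t| ≤ A)
    (hslope : ∀ i j : ℕ, i ≤ j → j ≤ n →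
      ((j : ℝ) - i) * d₁ ≤ c j - c i ∧ c j - c i ≤ ((j : ℝ) - i) * d₀)
    (hend : c n - c m ≤ ((n : ℝ) - m) * d₁ + L * ((n : ℝ) - m) ^ 2 / n)
    (hend' : L * ((n : ℝ) - m) ^ 2 / n ≤ 1) (hG : r + (d₁ - j) + 2 ≤ G)
    (hM1 : R * r - (d₁ - j) ≤ G * K * d₁ + N * (d₁ - j)) (hM2 : G * K * d₁ + N * (d₁ - j) ≤ R * r)
    (hfar : (G : ℝ) * K * (C + |d₀|) ≤ (R - 1) * r) (w : ℤ) :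
    ENNReal.ofReal (q ^ (G * K + N) * Real.exp (-(A * ((R + 1) * r)))) *
      ENNReal.ofReal (Real.exp (t * (w - c m)) * bump (r⁻¹ * (w - c m) - R)) ≤
      backOp P ξ c m (G * K + N) (Set.indicator {⌈c n⌉} 1) w := by
  have hnm : (n : ℝ) - m = G * K + N := by rw [← hm]; push_cast; ring
  have hmn : m ≤ n := by omega
  by_cases hb : bump (r⁻¹ * (w - c m) - R) = 0
  · simp [hb]
  obtain ⟨hb1, hb2⟩ := abs_le.1 (abs_le_one_of_bump_ne_zero hb)
  have hy1 : (R - 1) * r ≤ w - c m := by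
    have := mul_le_mul_of_nonneg_right (show R - 1 ≤ r⁻¹ * (w - c m) by linarith) hr.le
    rwa [mul_comm r⁻¹, mul_assoc, inv_mul_cancel₀ hr.ne', mul_one] at this
  have hy2 : w - c m ≤ (R + 1) * r := by
    have := mul_le_mul_of_nonneg_right (show r⁻¹ * (w - c m) ≤ R + 1 by linarith) hr.le
    rwa [mul_comm r⁻¹, mul_assoc, inv_mul_cancel₀ hr.ne', mul_one] at this
  have hy0 : 0 ≤ w - c m := le_trans (mul_nonneg (by linarith) hr.le) hy1
  have hpow : ENNReal.ofReal q ^ (G * K + N) ≤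
      backOp P ξ c m (G * K + N) (Set.indicator {⌈c n⌉} 1) w := by
    refine le_backOp_target (K := K) (C := C) (G := G) (N := N) hξ hblock hj hm ?_ ?_ ?_
    -- The discrepancy left to the blocks comes from the half-width `r` of the tube, the rounding
    -- `dm` of `N`, the curvature (at most `1`) and the ceiling (at most `1`).
    · have e1 := (hslope m n hmn le_rfl).1
      rw [hnm] at e1 hend hend'
      have e4 := Int.le_ceil (c n)
      have e5 := Int.ceil_lt_add_one (c n)
      have : |((⌈c n⌉ - N * j - w : ℤ) : ℝ)| ≤ G := by
        push_cast
        rw [abs_le]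
        constructor <;> linarith
      exact_mod_cast this
    · intro i hi
      have e1 := (hslope m (m + i) (by omega) (by omega)).2
      push_cast at e1
      have hi' : (i : ℝ) ≤ G * K := by exact_mod_cast hi
      have hi0 : (0 : ℝ) ≤ i := Nat.cast_nonneg i
      have e2 : (i : ℝ) * (C + |d₀|) ≤ G * K * (C + |d₀|) :=
        mul_le_mul_of_nonneg_right hi' (by positivity)
      have e3 : (i : ℝ) * d₀ ≤ i * |d₀| := mul_le_mul_of_nonneg_left (le_abs_self _) hi0
      linarith
    · intro k hk
      refine le_trans ?_ (hslope k n hk le_rfl).1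
      have : (k : ℝ) ≤ n := by exact_mod_cast hk
      exact mul_le_mul_of_nonneg_left hd₁.le (by linarith)
  refine le_trans ?_ hpow
  have hexp : Real.exp (-(A * ((R + 1) * r))) * (Real.exp (t * (w - c m)) *
      bump (r⁻¹ * (w - c m) - R)) ≤ 1 := by
    rw [← mul_assoc, ← Real.exp_add]
    refine mul_le_one₀ ?_ (bump_nonneg _) (bump_le_one _)
    rw [Real.exp_le_one_iff]
    have e1 : |t * (w - c m)| ≤ A * ((R + 1) * r) := by
      rw [abs_mul, abs_of_nonneg hy0]
      exact mul_le_mul ht hy2 hy0 hA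
    linarith [le_abs_self (t * (w - c m))]
  rw [← ENNReal.ofReal_mul (by positivity), ← ENNReal.ofReal_pow hq.le]
  refine ENNReal.ofReal_le_ofReal ?_
  rw [mul_assoc]
  exact mul_le_of_le_one_right (by positivity) hexp

set_option maxHeartbeats 1000000 in
/-- Lower bound for the killed kernel: the strategy of rising, staying in a tube at height of order
`n^{1/3}` and descending to the target costs `exp (-O(n^{1/3}))` on top of the sum of the rates. -/
lemma exists_le_backOp_target [IsProbabilityMeasure P] (hξ : Measurable ξ) {K : ℕ} {C q : ℝ}
    (hq : 0 < q) (hC : 0 ≤ C)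
    (hblock : ∀ (G : ℕ) (D : ℤ), |D| ≤ G → ∃ L : List ℤ, L.length = G * K ∧ L.sum = D ∧
        ∀ x ∈ L, ENNReal.ofReal q ≤ P {ω | ξ ω = x} ∧ -C ≤ (x : ℝ))
    {jp jm : ℤ} (hjp : 0 < P {ω | ξ ω = jp}) (hjm : 0 < P {ω | ξ ω = jm}) {d₀ d₁ L c₂ l A : ℝ}
    (hd₀ : d₀ < jp) (hd₁ : jm < d₁) (hL : 0 < L) (hc₂ : 0 ≤ c₂) (hl : 0 ≤ l) (hA : 0 ≤ A) :
    ∃ Λ r₀ : ℝ, ∀ (n : ℕ) (r : ℝ), r₀ ≤ r → r ^ 3 = n → ∀ c τ : ℕ → ℝ, c 0 = 0 →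
      (∀ i j : ℕ, i ≤ j → j ≤ n → ((j : ℝ) - i) * d₁ ≤ c j - c i ∧ c j - c i ≤ ((j : ℝ) - i) * d₀) →
      (∀ N ≤ n, N * d₀ - L * (N : ℝ) ^ 2 / n ≤ c N) →
      (∀ m ≤ n, c n - c m ≤ ((n : ℝ) - m) * d₁ + L * ((n : ℝ) - m) ^ 2 / n) →
      (∀ k < n, τ (k + 1) ∈ integrableExpSet (fun ω => (ξ ω : ℝ)) P) →
      (∀ k ≤ n, |τ k| ≤ A) →
      (∀ k < n, 0 ≤ τ k - τ (k + 1) ∧ τ k - τ (k + 1) ≤ c₂ / n) →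
      (∀ k < n, 0 ≤ τ (k + 1) * (c (k + 1) - c k) - cgf (fun ω => (ξ ω : ℝ)) P (τ (k + 1))) →
      (∀ k < n, ∀ w : ℝ, Real.exp (-l * r⁻¹ ^ 2) * bump w ≤
        ∫ ω, bump (w + r⁻¹ * (ξ ω - (c (k + 1) - c k)))
          ∂(P.tilted (fun ω => τ (k + 1) * (ξ ω : ℝ)))) →
      ENNReal.ofReal (Real.exp (-(∑ k ∈ Finset.range n, (τ (k + 1) * (c (k + 1) - c k) -
        cgf (fun ω => (ξ ω : ℝ)) P (τ (k + 1)))) - Λ * r)) ≤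
      backOp P ξ c 0 n (Set.indicator {⌈c n⌉} 1) 0 := by
  obtain ⟨R, B, r₀, hR, hB, hr₀, hphase⟩ := exists_phase_lengths (d₀ := d₀) (d₁ := d₁)
    (sub_pos.2 hd₀) (sub_pos.2 hd₁) hL hC K
  set q' := min (min q 1) (min (P.real {ω | ξ ω = jp}) (P.real {ω | ξ ω = jm})) with hq'
  have hq'0 : 0 < q' := lt_min (lt_min hq one_pos)
    (lt_min (ENNReal.toReal_pos hjp.ne' (measure_ne_top _ _))
      (ENNReal.toReal_pos hjm.ne' (measure_ne_top _ _)))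
  have hq'1 : q' ≤ 1 := (min_le_left _ _).trans (min_le_right _ _)
  have hq'q : ENNReal.ofReal q' ≤ ENNReal.ofReal q :=
    ENNReal.ofReal_le_ofReal ((min_le_left _ _).trans (min_le_left _ _))
  have hq'p : ENNReal.ofReal q' ≤ P {ω | ξ ω = jp} := by
    rw [← ofReal_measureReal]
    exact ENNReal.ofReal_le_ofReal ((min_le_right _ _).trans (min_le_left _ _))
  have hq'm : ENNReal.ofReal q' ≤ P {ω | ξ ω = jm} := by
    rw [← ofReal_measureReal]
    exact ENNReal.ofReal_le_ofReal ((min_le_right _ _).trans (min_le_right _ _))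
  set κ := -Real.log q' with hκ
  have hκ0 : 0 ≤ κ := neg_nonneg.2 (Real.log_nonpos hq'0.le hq'1)
  set l' := l + c₂ * (R + 1) with hl'
  have hl'0 : 0 ≤ l' := add_nonneg hl (mul_nonneg hc₂ (by linarith))
  -- The terms pay for the `O(r)` prescribed steps, the exponential weights on entering and leaving
  -- the tube, the stay in the tube, and the value of the bump at entry, which is at least `1/6 ≥
  -- e^{-2r}`.
  refine ⟨κ * B + 2 * A * (R + 1) + l' + 2, r₀, ?_⟩
  intro n r hr hrn c τ hc0 hslope hstart hend hτ hτA hdiff hI hstep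
  have hr1 : 1 ≤ r := hr₀.trans hr
  have hr0 : 0 < r := by linarith
  obtain ⟨N, G, N', htot, htot', hN, hN2, hG, hM1, hM2, hM3, hfar⟩ := hphase r hr
  have hn0 : (0 : ℝ) < n := by rw [← hrn]; positivity
  have htotn : N + (G * K + N') ≤ n := by
    rw [hrn] at htot'; exact_mod_cast htot'
  obtain ⟨m, hm⟩ : ∃ m, m + (G * K + N') = n := ⟨n - (G * K + N'), by omega⟩
  have hNm : N ≤ m := by omega
  have hmn : m ≤ n := by omega
  have hnm : (n : ℝ) - m = G * K + N' := by rw [← hm]; push_cast; ring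
  set I : ℕ → ℝ := fun k => τ (k + 1) * (c (k + 1) - c k) -
    cgf (fun ω => (ξ ω : ℝ)) P (τ (k + 1)) with hIdef
  set M := N + (G * K + N') with hM
  have hqM : Real.exp (-(κ * (B * r))) ≤ q' ^ M := by
    rw [← Real.exp_log hq'0, ← Real.exp_nat_mul]
    refine Real.exp_le_exp.2 ?_
    have : (M : ℝ) ≤ B * r := by rw [hM]; push_cast; linarith
    have := mul_le_mul_of_nonneg_left this hκ0
    rw [show Real.log q' = -κ by rw [hκ, neg_neg]]
    linarith
  have hfinal : ∀ w : ℤ, ENNReal.ofReal (q' ^ (G * K + N') * Real.exp (-(A * ((R + 1) * r)))) *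
      ENNReal.ofReal (Real.exp (τ m * (w - c m)) * bump (r⁻¹ * (w - c m) - R)) ≤
      backOp P ξ c m (G * K + N') (Set.indicator {⌈c n⌉} 1) w := by
    refine weighted_bump_le_backOp_target hξ hq'0 hC (fun D hD => ?_) hq'm hr0 hR hA hd₁ hm
      (hτA m hmn) hslope (hend m hmn) ?_ hG hM1 hM2 hfar
    · obtain ⟨L, h1, h2, h3⟩ := hblock G D hD
      exact ⟨L, h1, h2, fun x hx => ⟨hq'q.trans (h3 x hx).1, (h3 x hx).2⟩⟩
    · rw [hnm, div_le_one hn0, ← hrn]; exact hM3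
  have htube := bump_le_backOp hξ hNm hmn hr0 hrn (c := c) (τ := τ) hτ hR
    (fun k hk => (hdiff k hk).1) (fun k hk => (hdiff k hk).2) hstep (N * jp)
  have hinit := le_backOp_const_steps (P := P) (c := c) (φ := backOp P ξ c N (m - N)
    (backOp P ξ c m (G * K + N') (Set.indicator {⌈c n⌉} 1))) hξ hq'p N 0 0 (fun i hi _ => by
      have e1 := (hslope 0 i (by omega) (by omega)).2
      rw [hc0] at e1
      have e2 : (i : ℝ) * d₀ ≤ i * jp := mul_le_mul_of_nonneg_left hd₀.le (Nat.cast_nonneg i)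
      simp only [Nat.cast_zero, sub_zero] at e1
      rw [zero_add, Int.cast_zero]
      linarith)
  have hsplit : backOp P ξ c 0 n (Set.indicator {⌈c n⌉} 1) 0 =
      backOp P ξ c 0 N (backOp P ξ c N (m - N)
        (backOp P ξ c m (G * K + N') (Set.indicator {⌈c n⌉} 1))) 0 := by
    have e1 : n = N + ((m - N) + (G * K + N')) := by omega
    conv_lhs => rw [e1]
    rw [backOp_add, backOp_add, zero_add, show N + (m - N) = m by omega, ← e1]
  rw [hsplit]
  refine le_trans ?_ hinit
  rw [zero_add]
  have hmid : ENNReal.ofReal (q' ^ (G * K + N') * Real.exp (-(A * ((R + 1) * r)))) *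
      backOp P ξ c N (m - N) (fun w => ENNReal.ofReal (Real.exp (τ m * (w - c m)) *
        bump (r⁻¹ * (w - c m) - R))) (N * jp) ≤
      backOp P ξ c N (m - N) (backOp P ξ c m (G * K + N') (Set.indicator {⌈c n⌉} 1)) (N * jp) := by
    have := backOp_mono (P := P) (ξ := ξ) (c := c) hfinal (m - N) N (N * jp)
    rwa [backOp_const_mul hξ] at this
  refine le_trans ?_ (mul_le_mul_right ((mul_le_mul_right htube _).trans hmid) _)
  rw [← ENNReal.ofReal_pow hq'0.le, ← ENNReal.ofReal_mul (by positivity),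
    ← ENNReal.ofReal_mul (by positivity)]
  refine ENNReal.ofReal_le_ofReal ?_
  push_cast
  -- The height at entry is within `r/2` of `Rr`: `r/4` from rounding `N` and `r/4` from the
  -- curvature of the obstacle.
  set y : ℝ := N * jp - c N with hy
  have hNn : N ≤ n := by omega
  have hyl : N * (jp - d₀) ≤ y := by
    have := (hslope 0 N (by omega) hNn).2
    rw [hc0] at this
    simp only [Nat.cast_zero, sub_zero] at this
    rw [hy]; linarith
  have hyu : y ≤ N * (jp - d₀) + r / 4 := by
    have e1 := hstart N hNn
    have e2 : L * (N : ℝ) ^ 2 / n ≤ r / 4 := by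
      rw [div_le_iff₀ hn0, ← hrn]; linarith
    rw [hy]; linarith
  obtain ⟨hNl, hNu⟩ := abs_le.1 hN
  have hyabs : |y - R * r| ≤ r / 2 := by rw [abs_le]; constructor <;> linarith
  have hyR : |r⁻¹ * y - R| ≤ 3 / 4 := by
    have : r⁻¹ * y - R = r⁻¹ * (y - R * r) := by field_simp
    rw [this, abs_mul, abs_of_pos (inv_pos.2 hr0)]
    calc r⁻¹ * |y - R * r| ≤ r⁻¹ * (r / 2) := mul_le_mul_of_nonneg_left hyabs (inv_pos.2 hr0).le
      _ = 1 / 2 := by field_simp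
      _ ≤ 3 / 4 := by norm_num
  have hbump := le_bump_of_abs_le hyR
  have hy0 : 0 ≤ y := by
    have := (abs_le.1 hyabs).1
    have e1 : 1 * r ≤ R * r := mul_le_mul_of_nonneg_right hR hr0.le
    linarith
  have hτy : Real.exp (-(A * ((R + 1) * r))) ≤ Real.exp (τ N * y) := by
    refine Real.exp_le_exp.2 ?_
    have e1 : |τ N * y| ≤ A * ((R + 1) * r) := by
      rw [abs_mul, abs_of_nonneg hy0]
      refine mul_le_mul (hτA N hNn) ?_ hy0 hA
      have := (abs_le.1 hyabs).2
      linarith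
    linarith [neg_abs_le (τ N * y)]
  have hsix : Real.exp (-(2 * r)) ≤ 1 / 6 := by
    have e1 : Real.exp (-(2 * r)) ≤ Real.exp (-2) := Real.exp_le_exp.2 (by linarith)
    have e2 : (6 : ℝ) ≤ Real.exp 2 := by
      have := Real.exp_one_gt_d9
      have e3 : Real.exp 2 = Real.exp 1 ^ 2 := by rw [← Real.exp_nat_mul]; norm_num
      rw [e3]; nlinarith
    refine e1.trans ?_
    rw [Real.exp_neg, one_div]
    exact inv_anti₀ (by norm_num) e2
  -- Rates are nonnegative, so those of the first and last phases may be added.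
  have hsumI : ∑ k ∈ Finset.Ico N m, I k ≤ ∑ k ∈ Finset.range n, I k := by
    refine Finset.sum_le_sum_of_subset_of_nonneg (fun k hk => ?_) fun k hk _ => ?_
    · rw [Finset.mem_Ico] at hk
      exact Finset.mem_range.2 (by omega)
    · exact hI k (Finset.mem_range.1 hk)
  have hE : Real.exp (-(∑ k ∈ Finset.range n, I k) - l' * r) ≤
      Real.exp (-(∑ k ∈ Finset.Ico N m, I k) - l' * r⁻¹ ^ 2 * (m - N)) := by
    refine Real.exp_le_exp.2 ?_
    have e1 : (m : ℝ) - N ≤ r ^ 3 := by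
      rw [hrn]
      have : (m : ℝ) ≤ n := by exact_mod_cast hmn
      have : (0 : ℝ) ≤ N := Nat.cast_nonneg N
      linarith
    have e2 : r⁻¹ ^ 2 * (m - N) ≤ r := by
      calc r⁻¹ ^ 2 * (m - N) ≤ r⁻¹ ^ 2 * r ^ 3 := mul_le_mul_of_nonneg_left e1 (sq_nonneg _)
        _ = r := by field_simp
    have e3 := mul_le_mul_of_nonneg_left e2 hl'0
    linarith
  calc Real.exp (-(∑ k ∈ Finset.range n, I k) - (κ * B + 2 * A * (R + 1) + l' + 2) * r)
      = Real.exp (-(κ * (B * r))) * (Real.exp (-(A * ((R + 1) * r))) *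
          (Real.exp (-(∑ k ∈ Finset.range n, I k) - l' * r) * Real.exp (-(A * ((R + 1) * r))) *
            Real.exp (-(2 * r)))) := by
        simp only [← Real.exp_add]
        congr 1
        ring
    _ ≤ q' ^ M * (Real.exp (-(A * ((R + 1) * r))) *
          (Real.exp (-(∑ k ∈ Finset.Ico N m, I k) - l' * r⁻¹ ^ 2 * (m - N)) *
            Real.exp (τ N * y) * bump (r⁻¹ * y - R))) := by
        have hbn := bump_nonneg (r⁻¹ * y - R)
        have hb' := hsix.trans hbump
        gcongr
    _ = _ := by
        rw [hM, pow_add]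
        ring

end LowerBound

/-! ### Regularity of the rate and the choice of tilts -/

section Main

variable {Ω : Type*} [MeasurableSpace Ω] {P : Measure Ω} {Y : Ω → ℝ}

/-- Both exponents `±δ` are admissible. -/
lemma zero_between_tilts [IsFiniteMeasure P] (hY : Measurable Y) {δ : ℝ} (hδ : 0 < δ)
    (hexp : Integrable (fun ω => Real.exp (δ * |Y ω|)) P) :
    lowerTilt Y P < ((0 : ℝ) : EReal) ∧ ((0 : ℝ) : EReal) < upperTilt Y P := by
  have key : ∀ s : ℝ, |s| = δ → s ∈ integrableExpSet Y P := by
    intro s hs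
    refine hexp.mono' (by fun_prop) (Filter.Eventually.of_forall fun ω => ?_)
    rw [Real.norm_eq_abs, Real.abs_exp, ← hs, ← abs_mul]
    exact Real.exp_le_exp.2 (le_abs_self _)
  constructor
  · refine (sInf_le (Set.mem_image_of_mem _ (key (-δ) (by rw [abs_neg, abs_of_pos hδ])))).trans_lt ?_
    exact EReal.coe_lt_coe_iff.2 (by linarith)
  · refine lt_of_lt_of_le ?_ (le_sSup (Set.mem_image_of_mem _ (key δ (abs_of_pos hδ))))
    exact EReal.coe_lt_coe_iff.2 hδ

lemma not_ae_eq_const [IsProbabilityMeasure P] {σ : ℝ} (hσ : 0 < σ) (hmean : ∫ ω, Y ω ∂P = 0)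
    (hvar : ∫ ω, Y ω ^ 2 ∂P = σ ^ 2) (c : ℝ) : ¬ ∀ᵐ ω ∂P, Y ω = c := by
  intro hc
  have h1 : ∫ ω, Y ω ∂P = c := by
    rw [integral_congr_ae (g := fun _ => c) hc]; simp
  have h2 : ∫ ω, Y ω ^ 2 ∂P = c ^ 2 := by
    rw [integral_congr_ae (g := fun _ => c ^ 2) (by filter_upwards [hc] with ω hω; rw [hω])]; simp
  have h3 : c = 0 := by rw [← h1, hmean]
  rw [h2, h3] at hvar
  have : 0 < σ ^ 2 := by positivity
  norm_num at hvar
  linarith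

/-- The rate function is Lipschitz on the image of a compact interval of tilts. -/
lemma abs_rate_sub_le [IsProbabilityMeasure P] {a b : ℝ} (ha : lowerTilt Y P < (a : EReal))
    (hb : (b : EReal) < upperTilt Y P) {x y : ℝ} (hx : x ∈ deriv (cgf Y P) '' Set.Icc a b)
    (hy : y ∈ deriv (cgf Y P) '' Set.Icc a b) :
    |rate Y P x - rate Y P y| ≤ max |a| |b| * |x - y| := by
  have hI : ∀ t ∈ Set.Icc a b, lowerTilt Y P < (t : EReal) ∧ (t : EReal) < upperTilt Y P :=
    fun t ht => ⟨ha.trans_le (EReal.coe_le_coe_iff.2 ht.1),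
      (EReal.coe_le_coe_iff.2 ht.2).trans_lt hb⟩
  have aux : ∀ x ∈ deriv (cgf Y P) '' Set.Icc a b, ∀ y ∈ deriv (cgf Y P) '' Set.Icc a b,
      rate Y P x - rate Y P y ≤ max |a| |b| * |x - y| := by
    rintro _ ⟨t, ht, rfl⟩ _ ⟨s, hs, rfl⟩
    have h1 := rate_eq (hI t ht).1 (hI t ht).2 rfl
    -- The optimal tilt for the first slope competes at the second one, so the rates differ by at
    -- most `t` times the difference of the slopes.
    have h2 := le_rate (hI t ht).1 (hI t ht).2
      (isGreatest_legendreValues (hI s hs).1 (hI s hs).2 rfl).bddAbove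
    have h3 : |t * (deriv (cgf Y P) t - deriv (cgf Y P) s)| ≤
        max |a| |b| * |deriv (cgf Y P) t - deriv (cgf Y P) s| := by
      rw [abs_mul]
      exact mul_le_mul_of_nonneg_right (abs_le_max_abs_abs ht.1 ht.2) (abs_nonneg _)
    linarith [le_abs_self (t * (deriv (cgf Y P) t - deriv (cgf Y P) s))]
  rw [abs_sub_le_iff]
  refine ⟨aux x hx y hy, ?_⟩
  rw [abs_sub_comm]
  exact aux y hy x hx

/-- Tilts whose means are the increments of the obstacle; they decrease at rate `1/n`. -/
lemma exists_tilt_sequence [IsProbabilityMeasure P] {a b : ℝ} (hab : a ≤ b)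
    (hI : Set.Icc a b ⊆ interior (integrableExpSet Y P)) (hY : ∀ c : ℝ, ¬ ∀ᵐ ω ∂P, Y ω = c)
    {h : ℝ → ℝ} (hd : DifferentiableOn ℝ h (Set.Icc 0 1)) {m L : ℝ} (hm : 0 < m) (hL : 0 < L)
    (hbd : ∀ s s' : ℝ, 0 ≤ s → s ≤ s' → s' ≤ 1 →
      m * (s' - s) ≤ unitDeriv h s - unitDeriv h s' ∧
      unitDeriv h s - unitDeriv h s' ≤ L * (s' - s))
    (hslope : ∀ s ∈ Set.Icc (0 : ℝ) 1, unitDeriv h s ∈ deriv (cgf Y P) '' Set.Icc a b) :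
    ∃ c₁ c₂ : ℝ, 0 < c₁ ∧ 0 < c₂ ∧ ∀ n : ℕ, 1 ≤ n → ∃ τ : ℕ → ℝ,
      (∀ k < n, τ (k + 1) ∈ Set.Icc a b ∧
        deriv (cgf Y P) (τ (k + 1)) = obstacle h n (k + 1) - obstacle h n k) ∧
      (∀ k < n, c₁ / n ≤ τ k - τ (k + 1) ∧ τ k - τ (k + 1) ≤ c₂ / n) ∧
      ∀ k ≤ n, |τ k| ≤ max |a| |b| + c₁ := by
  obtain ⟨κ, κ', hκ, hκ', hcgf⟩ := exists_deriv_cgf_bounds hab hI hY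
  refine ⟨m / κ', max (L / κ) (m / κ'), by positivity, lt_max_of_lt_left (by positivity),
    fun n hn => ?_⟩
  have hn0 : (0 : ℝ) < n := by exact_mod_cast hn
  have hn1 : (1 : ℝ) ≤ n := by exact_mod_cast hn
  have hex : ∀ k : ℕ, ∃ t, k < n → t ∈ Set.Icc a b ∧ deriv (cgf Y P) t = slope h n k := by
    intro k
    by_cases hk : k < n
    · obtain ⟨s, hs1, hs2, e⟩ := exists_obstacle_sub_eq hd (Nat.lt_succ_self k) hk
      have hsI : s ∈ Set.Icc (0 : ℝ) 1 := by
        refine ⟨le_trans (by positivity) hs1, hs2.trans ?_⟩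
        rw [div_le_one hn0]; exact_mod_cast hk
      obtain ⟨t, ht, hte⟩ := hslope s hsI
      refine ⟨t, fun _ => ⟨ht, ?_⟩⟩
      rw [hte, slope, e]
      push_cast
      ring
    · exact ⟨0, fun h => absurd h hk⟩
  choose T hT using hex
  have hc1 : 0 < m / κ' := by positivity
  -- No step is tilted by `τ 0`; its value is chosen so that the first difference obeys the same
  -- bounds.
  let τ : ℕ → ℝ := fun k => Nat.casesOn k (T 0 + m / κ' / n) T
  have habs : ∀ k < n, |T k| ≤ max |a| |b| := fun k hk =>
    abs_le_max_abs_abs (hT k hk).1.1 (hT k hk).1.2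
  refine ⟨τ, hT, fun k hk => ?_, fun k hk => ?_⟩
  · cases k with
    | zero =>
      change m / κ' / n ≤ T 0 + m / κ' / n - T 0 ∧ T 0 + m / κ' / n - T 0 ≤ _
      rw [add_sub_cancel_left]
      exact ⟨le_rfl, div_le_div_of_nonneg_right (le_max_right _ _) hn0.le⟩
    | succ k =>
      change m / κ' / n ≤ T k - T (k + 1) ∧ T k - T (k + 1) ≤ _
      obtain ⟨h1, h2⟩ := slope_sub_slope_bounds hd hbd (n := n) (k := k) (by omega)
      obtain ⟨hk1, hk1'⟩ := hT k (by omega)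
      obtain ⟨hk2, hk2'⟩ := hT (k + 1) hk
      have hmn : 0 < m / n := by positivity
      have hle : T (k + 1) ≤ T k := by
        by_contra! hlt
        have := (hcgf _ hk1 _ hk2 hlt.le).1
        rw [hk1', hk2'] at this
        nlinarith [mul_pos hκ (sub_pos.2 hlt)]
      obtain ⟨h3, h4⟩ := hcgf _ hk2 _ hk1 hle
      rw [hk1', hk2'] at h3 h4
      constructor
      · rw [div_right_comm, div_le_iff₀ hκ']
        linarith
      · refine le_trans ?_ (div_le_div_of_nonneg_right (le_max_left _ _) hn0.le)
        rw [div_right_comm, le_div_iff₀ hκ]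
        linarith
  · cases k with
    | zero =>
      change |T 0 + m / κ' / n| ≤ _
      refine (abs_add_le _ _).trans (add_le_add (habs 0 (by omega)) ?_)
      rw [abs_of_pos (by positivity)]
      exact div_le_self hc1.le hn1
    | succ k =>
      exact (habs k (by omega)).trans (by linarith)

end Main

end ObstacleWalk

end

/-! ### Assembly of the two bounds -/

open ObstacleWalk

theorem theorem1 {Ω : Type*} [MeasurableSpace Ω] (P : Measure Ω) [IsProbabilityMeasure P]
    (X : ℕ → Ω → ℤ) (hmeas : ∀ i, Measurable (X i)) (hindep : iIndepFun X P)
    (hident : ∀ i, IdentDistrib (X i) (X 0) P P)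
    (hirr : ObstacleWalk.IsIrreducibleWalk X P) (haper : ObstacleWalk.IsAperiodicWalk X P)
    (Y : Ω → ℝ) (hY : Y = fun ω => (X 0 ω : ℝ))
    (σ δ : ℝ) (hσ : 0 < σ) (hδ : 0 < δ)
    (hmean : ∫ ω, Y ω ∂P = 0) (hvar : ∫ ω, Y ω ^ 2 ∂P = σ ^ 2)
    (hexp : Integrable (fun ω => Real.exp (δ * |Y ω|)) P)
    (a b : ℝ) (ha : ObstacleWalk.lowerTilt Y P < (a : EReal)) (hab : a < b)
    (hb : (b : EReal) < ObstacleWalk.upperTilt Y P)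
    (h : ℝ → ℝ) (hC2 : ContDiffOn ℝ 2 h (Set.Icc 0 1))
    (hnonneg : ∀ s ∈ Set.Icc (0 : ℝ) 1, 0 ≤ h s) (hconc : ConcaveOn ℝ (Set.Icc 0 1) h)
    (hneg : ∀ s ∈ Set.Icc (0 : ℝ) 1, ObstacleWalk.unitDeriv (ObstacleWalk.unitDeriv h) s < 0)
    (hslope : ∀ s ∈ Set.Icc (0 : ℝ) 1,
      ObstacleWalk.unitDeriv h s ∈ deriv (cgf Y P) '' Set.Icc a b)
    (h0 : h 0 = 0) :
    (∀ s ∈ Set.Icc (0 : ℝ) 1,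
      BddAbove (ObstacleWalk.legendreValues Y P (ObstacleWalk.unitDeriv h s))) ∧
    IntervalIntegrable (fun s => ObstacleWalk.rate Y P (ObstacleWalk.unitDeriv h s)) volume 0 1 ∧
    ∃ (cp cm : ℝ) (n₀ : ℕ), cm ≤ cp ∧ 0 < cm ∧ 1 ≤ n₀ ∧ ∀ n : ℕ, n₀ ≤ n →
      Real.exp (-cp * (n : ℝ) ^ (1 / 3 : ℝ)) ≤
        Real.exp ((n : ℝ) * ∫ s in (0 : ℝ)..1,
            ObstacleWalk.rate Y P (ObstacleWalk.unitDeriv h s)) *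
          P.real (ObstacleWalk.aboveEvent X h n) ∧
      Real.exp ((n : ℝ) * ∫ s in (0 : ℝ)..1,
            ObstacleWalk.rate Y P (ObstacleWalk.unitDeriv h s)) *
          P.real (ObstacleWalk.aboveEvent X h n) ≤
        Real.exp (-cm * (n : ℝ) ^ (1 / 3 : ℝ)) := by
  subst hY
  set Y : Ω → ℝ := fun ω => (X 0 ω : ℝ) with hYdef
  have hYm : Measurable Y := (measurable_ofInt _).comp (hmeas 0)
  have htilt : ∀ t ∈ Set.Icc a b, lowerTilt Y P < (t : EReal) ∧ (t : EReal) < upperTilt Y P :=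
    fun t ht => ⟨ha.trans_le (EReal.coe_le_coe_iff.2 ht.1),
      (EReal.coe_le_coe_iff.2 ht.2).trans_lt hb⟩
  have hI : Set.Icc a b ⊆ interior (integrableExpSet Y P) := fun t ht =>
    mem_interior_of_lt (htilt t ht).1 (htilt t ht).2
  obtain ⟨h0l, h0u⟩ := zero_between_tilts hYm hδ hexp
  have h0I : (0 : ℝ) ∈ interior (integrableExpSet Y P) := mem_interior_of_lt h0l h0u
  have hnd := not_ae_eq_const hσ hmean hvar
  have hdiffh : DifferentiableOn ℝ h (Set.Icc 0 1) := hC2.differentiableOn (by norm_num)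
  obtain ⟨m, L, hm, hL, hbd⟩ := exists_unitDeriv_bounds hC2 hneg
  have hbdd : ∀ s ∈ Set.Icc (0 : ℝ) 1, BddAbove (legendreValues Y P (unitDeriv h s)) := by
    intro s hs
    obtain ⟨t, ht, e⟩ := hslope s hs
    exact (isGreatest_legendreValues (htilt t ht).1 (htilt t ht).2 e).bddAbove
  set J : ℝ → ℝ := fun s => rate Y P (unitDeriv h s) with hJ
  set B := max |a| |b| * L with hB
  have hA0 : 0 ≤ max |a| |b| := (abs_nonneg a).trans (le_max_left _ _)
  have hB0 : 0 ≤ B := mul_nonneg hA0 hL.le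
  have hdlip : ∀ s ∈ Set.Icc (0 : ℝ) 1, ∀ s' ∈ Set.Icc (0 : ℝ) 1,
      |unitDeriv h s - unitDeriv h s'| ≤ L * |s - s'| := by
    have aux : ∀ s s' : ℝ, 0 ≤ s → s ≤ s' → s' ≤ 1 →
        |unitDeriv h s - unitDeriv h s'| ≤ L * |s - s'| := by
      intro s s' h1 h2 h3
      obtain ⟨e1, e2⟩ := hbd s s' h1 h2 h3
      have : 0 ≤ m * (s' - s) := mul_nonneg hm.le (by linarith)
      rw [abs_of_nonneg (by linarith), abs_sub_comm, abs_of_nonneg (by linarith)]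
      exact e2
    intro s hs s' hs'
    rcases le_total s s' with h1 | h1
    · exact aux s s' hs.1 h1 hs'.2
    · rw [abs_sub_comm, abs_sub_comm s]
      exact aux s' s hs'.1 h1 hs.2
  have hJlip : ∀ s ∈ Set.Icc (0 : ℝ) 1, ∀ s' ∈ Set.Icc (0 : ℝ) 1, |J s - J s'| ≤ B * |s - s'| := by
    intro s hs s' hs'
    refine (abs_rate_sub_le ha hb (hslope s hs) (hslope s' hs')).trans ?_
    rw [hB, mul_assoc]
    exact mul_le_mul_of_nonneg_left (hdlip s hs s' hs') hA0
  have hJint : IntervalIntegrable J volume 0 1 := by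
    have : LipschitzOnWith B.toNNReal J (Set.Icc 0 1) := by
      refine LipschitzOnWith.of_dist_le_mul fun s hs s' hs' => ?_
      rw [Real.dist_eq, Real.dist_eq, Real.coe_toNNReal _ hB0]
      exact hJlip s hs s' hs'
    refine ContinuousOn.intervalIntegrable ?_
    rw [Set.uIcc_of_le zero_le_one]
    exact this.continuousOn
  refine ⟨hbdd, hJint, ?_⟩
  set d₀ := unitDeriv h 0 with hd₀
  set d₁ := unitDeriv h 1 with hd₁
  have hdrange : ∀ s ∈ Set.Icc (0 : ℝ) 1, d₁ ≤ unitDeriv h s ∧ unitDeriv h s ≤ d₀ ∧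
      d₀ - L * s ≤ unitDeriv h s ∧ unitDeriv h s ≤ d₁ + L * (1 - s) := by
    intro s hs
    obtain ⟨e1, e2⟩ := hbd 0 s le_rfl hs.1 hs.2
    obtain ⟨e3, e4⟩ := hbd s 1 hs.1 hs.2 le_rfl
    have : 0 ≤ m * (s - 0) := mul_nonneg hm.le (by linarith [hs.1])
    have : 0 ≤ m * (1 - s) := mul_nonneg hm.le (by linarith [hs.2])
    refine ⟨?_, ?_, ?_, ?_⟩ <;> linarith
  -- `h'` decreases, so an atom above `d₀ = h'(0)` is steeper than the whole obstacle; likewise an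
  -- atom below `d₁ = h'(1)` is flatter.
  obtain ⟨jp, hjp, hjp'⟩ : ∃ j : ℤ, 0 < P {ω | X 0 ω = j} ∧ d₀ < j := by
    obtain ⟨t, ht, e⟩ := hslope 0 (by simp)
    obtain ⟨j, hj, hj'⟩ := exists_atom_gt (hI ht) hnd one_ne_zero
    refine ⟨j, hj, ?_⟩
    rw [← hYdef, e] at hj'
    linarith
  obtain ⟨jm, hjm, hjm'⟩ : ∃ j : ℤ, 0 < P {ω | X 0 ω = j} ∧ (j : ℝ) < d₁ := by
    obtain ⟨t, ht, e⟩ := hslope 1 (by simp)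
    obtain ⟨j, hj, hj'⟩ := exists_atom_gt (hI ht) hnd (neg_ne_zero.2 one_ne_zero)
    refine ⟨j, hj, ?_⟩
    rw [← hYdef, e] at hj'
    linarith
  obtain ⟨v, M, hv, hcent⟩ := exists_centred_tilted (hmeas 0) hI hab.le h0I hmean hjp hjm hjp' hjm'
  obtain ⟨c₁, c₂, hc₁, hc₂, hseq⟩ := exists_tilt_sequence hab.le hI hnd hdiffh hm hL hbd hslope
  set A := max |a| |b| + c₁ with hA
  have hA' : 0 ≤ A := by positivity
  obtain ⟨l, ε₁, hl, hε₁, hupper⟩ := Centred.satProfile_step hc₁ hv M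
  obtain ⟨l', ε₂, hl', hε₂, hlower⟩ := Centred.bump_step hv M
  obtain ⟨K, C, q, hq, hC, hblock⟩ := exists_blocks hident hirr haper
  obtain ⟨Λ, r₀, hΛ⟩ := exists_le_backOp_target (hmeas 0) hq hC hblock hjp hjm hjp' hjm' hL hc₂.le
    hl'.le hA'
  have hlim : Filter.Tendsto (fun n : ℕ => (n : ℝ) ^ (1 / 3 : ℝ)) Filter.atTop Filter.atTop :=
    (tendsto_rpow_atTop (by norm_num)).comp tendsto_natCast_atTop_atTop
  -- The last requirement, `2(A + B) ≤ l r`, lets half of the decay `l r` absorb the endpoint and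
  -- Riemann sum errors.
  obtain ⟨n₀, hn₀⟩ := Filter.eventually_atTop.1
    (hlim.eventually_ge_atTop (max (max 1 r₀) (max (max ε₁⁻¹ ε₂⁻¹) (2 * (A + B) / l))))
  -- The summand `l` in the first constant only serves to order the two constants.
  refine ⟨B + |Λ| + l, l / 2, max 1 n₀, by linarith [abs_nonneg Λ], by linarith, le_max_left _ _,
    fun n hn => ?_⟩
  have hn1 : 1 ≤ n := (le_max_left _ _).trans hn
  have hn0 : (0 : ℝ) < n := by exact_mod_cast hn1
  have hrn0 := hn₀ n ((le_max_right _ _).trans hn)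
  set r := (n : ℝ) ^ (1 / 3 : ℝ) with hr
  simp only [max_le_iff] at hrn0
  obtain ⟨⟨hr1, hrr₀⟩, ⟨hrε₁, hrε₂⟩, hrl⟩ := hrn0
  have hr0 : 0 < r := by linarith
  have hrn : r ^ 3 = n := by
    rw [hr, ← Real.rpow_natCast, ← Real.rpow_mul hn0.le]
    norm_num
  have hε1 : r⁻¹ ≤ ε₁ := inv_le_of_inv_le₀ hε₁ hrε₁
  have hε2 : r⁻¹ ≤ ε₂ := inv_le_of_inv_le₀ hε₂ hrε₂
  have hrinv : 0 < r⁻¹ := inv_pos.2 hr0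
  obtain ⟨τ, hτ, hτd, hτA⟩ := hseq n hn1
  set c := obstacle h n with hc
  have hc0 : c 0 = 0 := by simp [hc, obstacle, h0]
  have hmem : ∀ {x : ℝ} {i j : ℕ}, j ≤ n → (i : ℝ) / n ≤ x → x ≤ (j : ℝ) / n →
      x ∈ Set.Icc (0 : ℝ) 1 := by
    intro x i j hj h1 h2
    refine ⟨le_trans (by positivity) h1, h2.trans ?_⟩
    rw [div_le_one hn0]; exact_mod_cast hj
  have hcent' : ∀ k < n, Centred (P.tilted (fun ω => τ (k + 1) * (X 0 ω : ℝ)))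
      (fun ω => X 0 ω - (c (k + 1) - c k)) v M := by
    intro k hk
    obtain ⟨s, hs1, hs2, e⟩ := exists_obstacle_sub_eq hdiffh (Nat.lt_succ_self k) hk
    have hs := hdrange s (hmem hk hs1 hs2)
    have e' : c (k + 1) - c k = unitDeriv h s := by
      rw [hc, e]; push_cast; ring
    exact hcent _ (hτ k hk).1 _ (hτ k hk).2 (by rw [e']; exact hs.1) (by rw [e']; exact hs.2.1)
  have hprob : ∀ k < n, IsProbabilityMeasure (P.tilted (fun ω => τ (k + 1) * (X 0 ω : ℝ))) :=
    fun k hk => isProbabilityMeasure_tilted (interior_subset (hI (hτ k hk).1) :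
      τ (k + 1) ∈ integrableExpSet Y P)
  have hτI : ∀ k < n, τ (k + 1) ∈ integrableExpSet Y P := fun k hk =>
    interior_subset (hI (hτ k hk).1)
  set S := ∑ k ∈ Finset.range n, (τ (k + 1) * (c (k + 1) - c k) - cgf Y P (τ (k + 1))) with hS
  have hrate : ∀ k < n, rate Y P (c (k + 1) - c k) =
      τ (k + 1) * (c (k + 1) - c k) - cgf Y P (τ (k + 1)) := fun k hk =>
    rate_eq (htilt _ (hτ k hk).1).1 (htilt _ (hτ k hk).1).2 (hτ k hk).2
  have hSint : |S - n * ∫ s in (0 : ℝ)..1, J s| ≤ B := by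
    have hex : ∀ k : ℕ, ∃ s : ℝ, k < n → (k : ℝ) / n ≤ s ∧ s ≤ ((k + 1 : ℕ) : ℝ) / n ∧
        c (k + 1) - c k = unitDeriv h s := by
      intro k
      by_cases hk : k < n
      · obtain ⟨s, hs1, hs2, e⟩ := exists_obstacle_sub_eq hdiffh (Nat.lt_succ_self k) hk
        refine ⟨s, fun _ => ⟨hs1, hs2, ?_⟩⟩
        rw [hc, e]; push_cast; ring
      · exact ⟨0, fun h => absurd h hk⟩
    choose p hp using hex
    -- The increments of the obstacle are values of `h'` at mean value points, so `S` is a Riemann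
    -- sum of `J` with one node in each cell.
    have e : S = ∑ k ∈ Finset.range n, J (p k) := by
      refine Finset.sum_congr rfl fun k hk => ?_
      have hk' := Finset.mem_range.1 hk
      rw [← hrate k hk', (hp k hk').2.2]
    rw [e]
    exact abs_riemann_sum_sub_le hB0 hJlip hn1 fun k hk => ⟨(hp k hk).1, (hp k hk).2.1⟩
  obtain ⟨hS1, hS2⟩ := abs_le.1 hSint
  have hub := backOp_target_le (hmeas 0) hn1 hr0 hrn hc0 hτI (fun k hk => (hτd k hk).1)
    (hτA n le_rfl) (fun k hk x hx => by
      have := hprob k hk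
      exact hupper _ _ (hcent' k hk) r⁻¹ x hrinv hε1 hx)
  have hlb := hΛ n r hrr₀ hrn c τ hc0 (fun i j hij hj => by
      rcases hij.eq_or_lt with rfl | hij
      · simp
      obtain ⟨s, hs1, hs2, e⟩ := exists_obstacle_sub_eq hdiffh hij hj
      have hs := hdrange s (hmem hj hs1 hs2)
      have hij' : (0 : ℝ) ≤ (j : ℝ) - i := by
        have : (i : ℝ) < j := by exact_mod_cast hij
        linarith
      rw [hc, e]
      exact ⟨mul_le_mul_of_nonneg_left hs.1 hij', mul_le_mul_of_nonneg_left hs.2.1 hij'⟩)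
    (fun N hN => by
      rcases Nat.eq_zero_or_pos N with rfl | hNpos
      · simp [hc0]
      obtain ⟨s, hs1, hs2, e⟩ := exists_obstacle_sub_eq hdiffh hNpos hN
      have hs := (hdrange s (hmem hN hs1 hs2)).2.2.1
      rw [← hc, hc0] at e
      simp only [Nat.cast_zero, sub_zero] at e
      rw [e]
      have e1 : d₀ - L * ((N : ℝ) / n) ≤ unitDeriv h s := by
        have := mul_le_mul_of_nonneg_left hs2 hL.le
        linarith
      have e2 := mul_le_mul_of_nonneg_left e1 (Nat.cast_nonneg N)
      refine le_trans (le_of_eq ?_) e2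
      ring)
    (fun k hk => by
      rcases hk.eq_or_lt with rfl | hkn
      · simp
      obtain ⟨s, hs1, hs2, e⟩ := exists_obstacle_sub_eq hdiffh hkn le_rfl
      have hs := (hdrange s (hmem le_rfl hs1 hs2)).2.2.2
      rw [hc, e]
      have hnk : (0 : ℝ) ≤ (n : ℝ) - k := by
        have : (k : ℝ) < n := by exact_mod_cast hkn
        linarith
      have e1 : unitDeriv h s ≤ d₁ + L * (1 - (k : ℝ) / n) := by
        have := mul_le_mul_of_nonneg_left hs1 hL.le
        linarith
      refine (mul_le_mul_of_nonneg_left e1 hnk).trans (le_of_eq ?_)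
      field_simp)
    hτI hτA (fun k hk => ⟨(div_nonneg hc₁.le hn0.le).trans (hτd k hk).1, (hτd k hk).2⟩)
    (fun k hk => by
      rw [← hYdef, ← hrate k hk]
      have hbdd' := (isGreatest_legendreValues (htilt _ (hτ k hk).1).1 (htilt _ (hτ k hk).1).2
        (hτ k hk).2).bddAbove
      -- The tilt `0` is admissible and contributes the value `0`, so the rate is nonnegative.
      have := le_rate h0l h0u hbdd'
      simpa using this)
    (fun k hk w => by
      have := hprob k hk
      exact hlower _ _ (hcent' k hk) r⁻¹ w hrinv hε2)
  rw [← measure_aboveEvent hmeas hindep hident h0] at hub hlb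
  rw [← hYdef, ← hS] at hub hlb
  have hub' : P.real (aboveEvent X h n) ≤ Real.exp (A - S - l * r) :=
    ENNReal.toReal_le_of_le_ofReal (Real.exp_pos _).le hub
  have hlb' : Real.exp (-S - Λ * r) ≤ P.real (aboveEvent X h n) :=
    (ENNReal.ofReal_le_iff_le_toReal (measure_ne_top _ _)).1 hlb
  set T := (n : ℝ) * ∫ s in (0 : ℝ)..1, J s with hT
  constructor
  · refine le_trans ?_ (mul_le_mul_of_nonneg_left hlb' (Real.exp_pos T).le)
    rw [← Real.exp_add]
    refine Real.exp_le_exp.2 ?_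
    have e1 : Λ * r ≤ |Λ| * r := mul_le_mul_of_nonneg_right (le_abs_self Λ) hr0.le
    have e2 : B * 1 ≤ B * r := mul_le_mul_of_nonneg_left hr1 hB0
    have e3 : 0 ≤ l * r := by positivity
    linarith
  · refine (mul_le_mul_of_nonneg_left hub' (Real.exp_pos T).le).trans ?_
    rw [← Real.exp_add]
    refine Real.exp_le_exp.2 ?_
    rw [div_le_iff₀ hl] at hrl
    linarith
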